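/- Let $\Delta>0$ be an integer, $K=\mathbb{Q}(\sqrt{-\Delta})$, $p\neq 2$ a prime with $\left(\frac{-\Delta}{p}\right)=-1$ (so $p$ is inert in $K$), and $N\ge 1$ an integer prime to $p$. Let $E=\mathrm{diag}(1,-1,-1)$ and $J=\begin{pmatrix}0&1\\-1&0\end{pmatrix}$ (blocks of size $3$), and let $G=GSp_6$ be the group of similitudes of $J$. Let $G_V=GU(1,2)$ be the group of $\mathfrak g=h+k\sqrt{-\Delta}$ with $\mathfrak gE\bar{\mathfrak g}^t=\lambda E$, embedded in $G$ by $$\alpha(h+k\sqrt{-\Delta})=\begin{pmatrix}h&kE\\-\Delta Ek&EhE\end{pmatrix}.$$ Let $\mathcal D$ be the $G(\mathbb R)$-conjugacy class of the homomorphism $a+bi\mapsto a+bJ$, and $\mathcal D_V\subset\mathcal D$ the $G_V(\mathbb R)$-conjugacy class of $\alpha\circ h_V$, where $h_V(z)=\mathrm{diag}(z,\bar z,\bar z)$. Let $\mathcal K\subset G(\hat{\mathbb Z})$ be the subgroup of elements whose lower left $3\times3$ block is divisible by $N$, and $\Gamma=\mathcal K\cap G(\mathbb Q)$. For a subgroup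 $\mathcal K'\subset\mathcal K$ let $X_{\mathcal K'}=[\mathcal D\times\mathcal K'\backslash G(\mathbb A_f)]/G(\mathbb Q)$, where $q\in G(\mathbb Q)$ sends $(z,g)$ to $(qz,gq^{-1})$. Put $X=X_{\mathcal K}$, $V=\{[z,\alpha(g)]: z\in\mathcal D_V,\ g\in G_V(\mathbb A_f)\}\subset X$ and $V_c=\{[z,1]: z\in\mathcal D_V\}$, the irreducible component of $V$ attached to the trivial double coset. Let $\tau=\mathrm{diag}(p,1,1,p,p^2,p^2)$, $\mathcal K_p=\mathcal K\cap\tau^{-1}\mathcal K\tau$ and $X_p=X_{\mathcal K_p}$. The Hecke correspondence $T_{p,1}$ is given by $\pi_1:X_p\to X$, $[z,g]\mapsto[z,g]$, and $\pi_2:X_p\to X$, $[z,g]\mapsto[\tau z,\tau g\tau^{-1}]$. Fix systems of representatives of $\mathbb Z$ modulo $p$ and modulo $p^2$. Let $S=S(3,1)^{open}$ be the set of matrices (diagonal blocks of sizes $1,2,1,2$) $$\sigma=\begin{pmatrix}p&0&0&pC^t\\-A&1&C&U\\0&0&p&pA^t\\0&0&0&p^2\end{pmatrix},\qquad CA^t-AC^t=U-U^t,$$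 where $A,C$ are integral $2\times1$ matrices with entries in the first system, and $U$ is an integral $2\times 2$ matrix with diagonal and upper-triangular entries in the second. For $\sigma\in S$ put $r_\sigma=\tau^{-1}\sigma\in\Gamma$. For $s\in\Gamma$ let $V_{p,s}^s=\{[sz,s\alpha(g)s^{-1}]: z\in\mathcal D_V,\ g\in G_V(\mathbb A_f)\}\subset X_p$, and let $Y_s=\{[sz,1]: z\in\mathcal D_V\}\subset X_p$ (an irreducible component of the preimage of $V_c$ in the component of $X_p$ over the trivial double coset). Put $T_{p,1}(V)_{I(\sigma)}=\pi_2(Y_{r_\sigma})$ and $T_{p,1}(V)_{D(\sigma)}=\pi_2(V_{p,r_\sigma}^{r_\sigma})$. Elements $\sigma_1,\sigma_2\in S$ are D-equivalent if $Y_{r_{\sigma_1}}\cup Y_{r_{\sigma_2}}\subset V_{p,s}^s$ for some $s\in\Gamma$; the equivalence classes in $S$ are the parts of the D-partition. Let $$\mu_1(\sigma)=\begin{pmatrix}-1&-C^t\sqrt{-\Delta}\\A+C\sqrt{-\Delta}&-1-U\sqrt{-\Delta}\end{pmatrix},\qquad \mu_2(\sigma)=\begin{pmatrix}\sqrt{-\Delta}&-A^t\sqrt{-\Delta}\\A+C\sqrt{-\Delta}&-1-U\sqrt{-\Delta}\end{pmatrix},$$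 and let $\mathfrak D_*$ be the set of $\sigma\in S$ with $\det\mu_1(\sigma)\equiv\det\mu_2(\sigma)\equiv0$ modulo $p$. Let $W_\sigma\subset(\mathbb Z/p^2)^6$ be the span of the rows of $\sigma$, let $O_KW_\sigma$ be the submodule generated by $W_\sigma$ and $W_\sigma\,\alpha(\sqrt{-\Delta})$, and let $\mathfrak D_{0,*}$ be the set of $\sigma\in\mathfrak D_*$ such that $M=O_KW_\sigma$ has $\dim_{\mathbb F_p}M/M_p=2$ and $\dim_{\mathbb F_p}M_p=4$, where $M_p$ is the $p$-torsion of $M$. Then: (1) for every $\sigma\in\mathfrak D_*$ we have $T_{p,1}(V)_{I(\sigma)}=V_c$ if and only if $\sigma\in\mathfrak D_{0,*}$; (2) $\mathfrak D_{0,*}$ is a part of the D-partition of $S$; (3) it is the only part whose component is $V$: for every part $k$ of the D-partition and every $\sigma\in k$, $T_{p,1}(V)_{I(\sigma)}=V_c$ if and only if $k=\mathfrak D_{0,*}$, and $T_{p,1}(V)_{D(\sigma)}=V$ if and only if $k=\mathfrak D_{0,*}$. -/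

import Mathlib

open Matrix

namespace Picard

/-! ### Similitude groups -/

/-- Index set of `3 × 3` matrices, with diagonal blocks of sizes `1` and `2`. -/
abbrev Blk : Type := Fin 1 ⊕ Fin 2

/-- Index set of `6 × 6` matrices, with diagonal blocks of sizes `1, 2, 1, 2`. -/
abbrev Idx : Type := Blk ⊕ Blk

/-- The standard symplectic matrix. -/
def symJ (R : Type*) [CommRing R] : Matrix Idx Idx R := fromBlocks 0 1 (-1) 0

/-- The group `GSp₆(R)` of symplectic similitudes. -/
def GSp (R : Type*) [CommRing R] : Subgroup (GL Idx R) where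
  carrier := {g | ∃ c : Rˣ, (g : Matrix Idx Idx R) * symJ R * (g : Matrix Idx Idx R)ᵀ =
    (c : R) • symJ R}
  mul_mem' := by
    rintro a b ⟨c, hc⟩ ⟨d, hd⟩
    refine ⟨c * d, ?_⟩
    have : ((a * b : GL Idx R) : Matrix Idx Idx R) * symJ R *
        ((a * b : GL Idx R) : Matrix Idx Idx R)ᵀ =
        (a : Matrix Idx Idx R) * ((b : Matrix Idx Idx R) * symJ R * (b : Matrix Idx Idx R)ᵀ) *
          (a : Matrix Idx Idx R)ᵀ := by
      simp only [Units.val_mul, transpose_mul, Matrix.mul_assoc]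
    rw [this, hd, Matrix.mul_smul, Matrix.smul_mul, hc, smul_smul, Units.val_mul, mul_comm]
  one_mem' := ⟨1, by simp⟩
  inv_mem' := by
    rintro a ⟨c, hc⟩
    refine ⟨c⁻¹, ?_⟩
    have h1 : ((a⁻¹ : GL Idx R) : Matrix Idx Idx R) * (a : Matrix Idx Idx R) = 1 := by
      rw [← Units.val_mul, inv_mul_cancel, Units.val_one]
    have h2 : (a : Matrix Idx Idx R)ᵀ * ((a⁻¹ : GL Idx R) : Matrix Idx Idx R)ᵀ = 1 := by
      rw [← transpose_mul, h1, transpose_one]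
    have h3 : symJ R = ((c⁻¹ : Rˣ) : R) • ((a : Matrix Idx Idx R) * symJ R *
        (a : Matrix Idx Idx R)ᵀ) := by
      rw [hc, smul_smul, Units.inv_mul, one_smul]
    have h4 : ((a⁻¹ : GL Idx R) : Matrix Idx Idx R) * ((a : Matrix Idx Idx R) * symJ R *
        (a : Matrix Idx Idx R)ᵀ) * ((a⁻¹ : GL Idx R) : Matrix Idx Idx R)ᵀ = symJ R := by
      rw [Matrix.mul_assoc, Matrix.mul_assoc _ _ ((a⁻¹ : GL Idx R) : Matrix Idx Idx R)ᵀ, h2,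
        Matrix.mul_one, ← Matrix.mul_assoc, h1, Matrix.one_mul]
    conv_lhs => rw [h3]
    rw [Matrix.mul_smul, Matrix.smul_mul, h4]

/-- The underlying matrix of a similitude. -/
def toMat {R : Type*} [CommRing R] (g : GSp R) : Matrix Idx Idx R := ((g : GL Idx R) : _)

theorem symJ_mul_symJ (R : Type*) [CommRing R] : symJ R * symJ R = -1 := by
  simp [symJ, fromBlocks_multiply, ← fromBlocks_one, fromBlocks_neg]

/-- A matrix `M` with `M J Mᵀ = c J`, `c` a unit, as an element of `GSp₆(R)`. -/
def GSp.mk {R : Type*} [CommRing R] (M : Matrix Idx Idx R) (c : Rˣ)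
    (h : M * symJ R * Mᵀ = (c : R) • symJ R) : GSp R :=
  have h1 : M * (-((c⁻¹ : Rˣ) : R) • (symJ R * Mᵀ * symJ R)) = 1 := by
    rw [Matrix.mul_smul, ← Matrix.mul_assoc, ← Matrix.mul_assoc, h, Matrix.smul_mul,
      symJ_mul_symJ, smul_smul]
    simp
  ⟨⟨M, -((c⁻¹ : Rˣ) : R) • (symJ R * Mᵀ * symJ R), h1, mul_eq_one_comm.mp h1⟩, c, h⟩

/-- Extension of scalars `GSp₆(R) → GSp₆(S)`. -/
def GSp.map {R S : Type*} [CommRing R] [CommRing S] (f : R →+* S) : GSp R →* GSp S :=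
  ((GeneralLinearGroup.map (n := Idx) f).comp (GSp R).subtype).codRestrict (GSp S) (by
    rintro ⟨g, c, hc⟩
    refine ⟨Units.map (f : R →* S) c, ?_⟩
    have hJ : (symJ R).map f = symJ S := by
      simp [symJ, fromBlocks_map, Matrix.map_one, Matrix.map_neg]
    have h := congrArg (fun M : Matrix Idx Idx R => M.map f) hc
    simp only [Matrix.map_mul] at h
    rw [hJ] at h
    have h' : (((c : R) • symJ R).map f : Matrix Idx Idx S) = f c • symJ S := by
      rw [← hJ]; ext i j; simp
    rw [h'] at h
    exact h)

/-- The matrix `E = diag(1, -1, -1)` of the Hermitian form of signature `(1, 2)`. -/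
def hermE (R : Type*) [CommRing R] : Matrix Blk Blk R := fromBlocks 1 0 0 (-1)

/-- The image under `G_V → GSp₆` of `h + k √-Δ`. -/
def alpha {R : Type*} [CommRing R] (Δ : ℕ) (h k : Matrix Blk Blk R) : Matrix Idx Idx R :=
  fromBlocks h (k * hermE R) (-((Δ : R) • (hermE R * k))) (hermE R * h * hermE R)

/-- The group `G_V(R) = GU(1,2)(R)`, embedded in `GSp₆(R)` by `alpha`: the elements `h + k √-Δ`
with `(h + k √-Δ) E (h - k √-Δ)ᵀ = c E`, written out in `h` and `k`. -/
def GV (Δ : ℕ) (R : Type*) [CommRing R] : Set (GSp R) :=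
  {g | ∃ (h k : Matrix Blk Blk R) (c : Rˣ), toMat g = alpha Δ h k ∧
    h * hermE R * hᵀ + (Δ : R) • (k * hermE R * kᵀ) = (c : R) • hermE R ∧
    k * hermE R * hᵀ = h * hermE R * kᵀ}

/-! ### Shimura varieties

A homomorphism `h : ℂˣ → GSp₆(ℝ)` in the conjugacy class of the standard one,
`a + b i ↦ a + b J`, is recorded by its value `h(i)`, which determines it. -/

/-- The Hermitian symmetric domain of `GSp₆`: the `GSp₆(ℝ)`-conjugacy class of `h_X(i) = J`. -/
def Dom : Set (GSp ℝ) :=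
  {j | ∃ g : GSp ℝ, j = g * GSp.mk (symJ ℝ) 1 (by
    simp [symJ, fromBlocks_multiply, fromBlocks_transpose]) * g⁻¹}

/-- The action of `GSp₆(ℚ)` on the domain. -/
noncomputable def act (q : GSp ℚ) (j : Dom) : Dom :=
  ⟨GSp.map (algebraMap ℚ ℝ) q * j.1 * (GSp.map (algebraMap ℚ ℝ) q)⁻¹, by
    obtain ⟨g, hg⟩ := j.2
    exact ⟨GSp.map (algebraMap ℚ ℝ) q * g, by rw [hg]; group⟩⟩

/-- The value at `i` of the standard homomorphism `z ↦ diag(z, z̄, z̄)` into `GU(1,2)(ℝ)`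
(`diag(i, -i, -i)` is `0 + (E / √Δ) √-Δ`), embedded by `alpha`. -/
noncomputable def hV (Δ : ℕ) : Matrix Idx Idx ℝ :=
  alpha Δ 0 ((Real.sqrt Δ)⁻¹ • hermE ℝ)

/-- The subdomain of `G_V`: the `G_V(ℝ)`-conjugacy class of `h_V`. -/
def DomV (Δ : ℕ) : Set Dom :=
  {j | ∃ g ∈ GV Δ ℝ, toMat j.1 = toMat g * hV Δ * toMat g⁻¹}

/-- The ring of finite adeles of `ℚ`. -/
abbrev Af : Type := IsDedekindDomain.FiniteAdeleRing ℤ ℚ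

/-- Integral finite adeles. -/
def IsIntegralAdele (x : Af) : Prop := ∀ v, x v ∈ v.adicCompletionIntegers ℚ

/-- The diagonal embedding `GSp₆(ℚ) → GSp₆(𝔸_f)`. -/
noncomputable def diagA : GSp ℚ →* GSp Af := GSp.map (algebraMap ℚ Af)

/-- The level subgroup `𝒦` of level `N`: elements of `GSp₆(Ẑ)` whose lower left `3 × 3` block is
divisible by `N`. -/
def level (N : ℕ) : Set (GSp Af) :=
  {g | (∀ i j, IsIntegralAdele (toMat g i j)) ∧ (∀ i j, IsIntegralAdele (toMat g⁻¹ i j)) ∧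
    ∀ i j : Blk, ∃ y, IsIntegralAdele y ∧ toMat g (Sum.inr i) (Sum.inl j) = (N : Af) * y}

/-- `Γ = 𝒦 ∩ GSp₆(ℚ)`. -/
def Gam (N : ℕ) : Set (GSp ℚ) := {q | diagA q ∈ level N}

/-- The relation whose quotient is `[𝒟 × 𝒦' \ G(𝔸_f)] / G(ℚ)`. -/
def shRel (K' : Set (GSp Af)) (x y : Dom × GSp Af) : Prop :=
  ∃ q : GSp ℚ, ∃ k ∈ K', y.1 = act q x.1 ∧ y.2 = k * x.2 * (diagA q)⁻¹

/-- The (complex points of the) Shimura variety of `GSp₆` of level `K'`. -/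
def ShVar (K' : Set (GSp Af)) : Type := Quot (shRel K')

/-- The point `[z, g]`. -/
def pt (K' : Set (GSp Af)) (z : Dom) (g : GSp Af) : ShVar K' := Quot.mk _ (z, g)

/-- The Shimura subvariety `V` of `X`. -/
def subV (N Δ : ℕ) : Set (ShVar (level N)) :=
  {x | ∃ z ∈ DomV Δ, ∃ g ∈ GV Δ Af, x = pt _ z g}

/-- The irreducible component of `V` that corresponds to the trivial double coset. -/
def subVc (N Δ : ℕ) : Set (ShVar (level N)) :=
  {x | ∃ z ∈ DomV Δ, x = pt _ z 1}

/-! ### The Hecke correspondence `T_{p,1}` -/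

/-- The matrix `diag(p, 1, 1, p, p², p²)`. -/
def tauMat (p : ℕ) (R : Type*) [CommRing R] : Matrix Idx Idx R :=
  fromBlocks (fromBlocks ((p : R) • 1) 0 0 1) 0 0 (fromBlocks ((p : R) • 1) 0 0 ((p : R) ^ 2 • 1))

theorem tauMat_similitude (p : ℕ) (R : Type*) [CommRing R] :
    tauMat p R * symJ R * (tauMat p R)ᵀ = (p : R) ^ 2 • symJ R := by
  simp [tauMat, symJ, fromBlocks_multiply, fromBlocks_transpose, fromBlocks_smul,
    ← fromBlocks_one, smul_smul, pow_two, fromBlocks_neg]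

/-- The unit `p²` of `ℚ`. -/
def unitSq (p : ℕ) [Fact p.Prime] : ℚˣ :=
  Units.mk0 ((p : ℚ) ^ 2) (pow_ne_zero 2 (Nat.cast_ne_zero.mpr (Fact.out : p.Prime).ne_zero))

/-- `diag(p, 1, 1, p, p², p²)` as an element of `GSp₆(ℚ)`. -/
def tau (p : ℕ) [Fact p.Prime] : GSp ℚ :=
  GSp.mk (tauMat p ℚ) (unitSq p) (tauMat_similitude p ℚ)

/-- The level subgroup `𝒦_p = 𝒦 ∩ τ⁻¹ 𝒦 τ` of the correspondence. -/
def levelP (N p : ℕ) [Fact p.Prime] : Set (GSp Af) :=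
  {g | g ∈ level N ∧ diagA (tau p) * g * (diagA (tau p))⁻¹ ∈ level N}

/-- The second projection `X_p → X`, `[z, g] ↦ [τ z, τ g τ⁻¹]`. (The first one is
`[z, g] ↦ [z, g]`.) -/
noncomputable def proj2 (N p : ℕ) [Fact p.Prime] : ShVar (levelP N p) → ShVar (level N) :=
  Quot.map (fun x => (act (tau p) x.1, diagA (tau p) * x.2 * (diagA (tau p))⁻¹)) (by
    rintro ⟨z, g⟩ ⟨z', g'⟩ ⟨q, k, hk, h1, h2⟩
    refine ⟨tau p * q * (tau p)⁻¹, _, hk.2, ?_, ?_⟩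
    · simp only at h1
      subst h1
      apply Subtype.ext
      simp only [act, map_mul, map_inv]
      group
    · simp only at h2 ⊢
      subst h2
      simp only [map_mul, map_inv]
      group)

/-- Data of an open representative: integral matrices with `C Aᵀ - A Cᵀ = U - Uᵀ`. -/
@[ext] structure OpenRep where
  A : Matrix (Fin 2) (Fin 1) ℤ
  C : Matrix (Fin 2) (Fin 1) ℤ
  U : Matrix (Fin 2) (Fin 2) ℤ
  rel : C * Aᵀ - A * Cᵀ = U - Uᵀ

/-- The representative
`σ = (p, 0, 0, p Cᵀ; -A, 1, C, U; 0, 0, p, p Aᵀ; 0, 0, 0, p²)`. -/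
def OpenRep.mat (p : ℕ) (σ : OpenRep) : Matrix Idx Idx ℤ :=
  fromBlocks
    (fromBlocks ((p : ℤ) • 1) 0 (-σ.A) 1)
    (fromBlocks 0 ((p : ℤ) • σ.Cᵀ) σ.C σ.U)
    0
    (fromBlocks ((p : ℤ) • 1) ((p : ℤ) • σ.Aᵀ) 0 ((p : ℤ) ^ 2 • 1))

theorem OpenRep.mat_similitude (p : ℕ) (σ : OpenRep) :
    σ.mat p * symJ ℤ * (σ.mat p)ᵀ = (p : ℤ) ^ 2 • symJ ℤ := by
  have h2 : -σ.U + σ.C * σ.Aᵀ + (-(σ.A * σ.Cᵀ) + σ.Uᵀ) = 0 := by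
    have h := sub_eq_zero.mpr σ.rel
    rw [← h]
    abel
  have h3 : σ.C * σ.Aᵀ + -σ.U + (-(σ.A * σ.Cᵀ) + σ.Uᵀ) = 0 := by
    rw [← h2]
    abel
  simp only [OpenRep.mat, symJ, fromBlocks_multiply, fromBlocks_transpose, fromBlocks_smul,
    fromBlocks_neg, fromBlocks_add, Matrix.mul_zero, Matrix.zero_mul,
    Matrix.mul_one, Matrix.one_mul, zero_add, add_zero, neg_zero, transpose_zero, transpose_one,
    transpose_neg, transpose_smul, transpose_transpose, Matrix.mul_neg, Matrix.neg_mul,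
    Matrix.smul_mul, Matrix.mul_smul, smul_zero, smul_smul, smul_neg, pow_two, neg_neg]
  simp only [h3, add_neg_cancel, neg_add_cancel, fromBlocks_zero]
  rw [← fromBlocks_one, fromBlocks_smul, fromBlocks_neg]
  simp

/-- The representative over an arbitrary ring. -/
def sigmaMat (p : ℕ) (σ : OpenRep) (R : Type*) [CommRing R] : Matrix Idx Idx R :=
  (σ.mat p).map (Int.castRingHom R)

theorem sigmaMat_similitude (p : ℕ) (σ : OpenRep) (R : Type*) [CommRing R] :
    sigmaMat p σ R * symJ R * (sigmaMat p σ R)ᵀ = (p : R) ^ 2 • symJ R := by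
  have hJ : (symJ ℤ).map (Int.castRingHom R) = symJ R := by
    simp [symJ, fromBlocks_map, Matrix.map_one, Matrix.map_neg]
  have h := congrArg (fun M : Matrix Idx Idx ℤ => M.map (Int.castRingHom R))
    (σ.mat_similitude p)
  simp only [Matrix.map_mul] at h
  rw [hJ] at h
  have h' : (((p : ℤ) ^ 2 • symJ ℤ).map (Int.castRingHom R) : Matrix Idx Idx R) =
      (p : R) ^ 2 • symJ R := by
    rw [← hJ]; ext i j; simp [Matrix.smul_apply, -zsmul_eq_mul]
  rw [h'] at h
  exact h

/-- The representative as an element of `GSp₆(ℚ)`. -/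
def OpenRep.toGSp (p : ℕ) [Fact p.Prime] (σ : OpenRep) : GSp ℚ :=
  GSp.mk (sigmaMat p σ ℚ) (unitSq p) (sigmaMat_similitude p σ ℚ)

/-- `R` contains exactly one representative of each residue class modulo `n`. -/
def IsResidueSystem (n : ℕ) (R : Set ℤ) : Prop := ∀ a : ℤ, ∃! r, r ∈ R ∧ (n : ℤ) ∣ a - r

/-- The set `S(3,1)^open` attached to a system `R₁` of residues modulo `p` and a system `R₂` of
residues modulo `p²`. -/
def SOpen (R₁ R₂ : Set ℤ) : Set OpenRep :=
  {σ | (∀ i j, σ.A i j ∈ R₁) ∧ (∀ i j, σ.C i j ∈ R₁) ∧ ∀ i j, i ≤ j → σ.U i j ∈ R₂}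

/-! ### Components and D-equivalence -/

/-- The irreducible component of `π_c⁻¹(V_c) ⊆ X_p` that corresponds to `r ∈ Γ`. -/
def compP (N p Δ : ℕ) [Fact p.Prime] (r : GSp ℚ) : Set (ShVar (levelP N p)) :=
  {x | ∃ z ∈ DomV Δ, x = pt _ (act r z) 1}

/-- The Shimura subvariety of `X_p` attached to `s ∈ Γ`, i.e. to the conjugate `s G_V s⁻¹`. -/
def conjV (N p Δ : ℕ) [Fact p.Prime] (s : GSp ℚ) : Set (ShVar (levelP N p)) :=
  {x | ∃ z ∈ DomV Δ, ∃ g ∈ GV Δ Af, x = pt _ (act s z) (diagA s * g * (diagA s)⁻¹)}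

/-- The element `r ∈ Γ` with `σ = τ r`. -/
def OpenRep.toGam (p : ℕ) [Fact p.Prime] (σ : OpenRep) : GSp ℚ := (tau p)⁻¹ * σ.toGSp p

/-- D-equivalence: both components lie in one Shimura subvariety of the above kind. -/
def DEquiv (N p Δ : ℕ) [Fact p.Prime] (σ₁ σ₂ : OpenRep) : Prop :=
  ∃ s ∈ Gam N, compP N p Δ (σ₁.toGam p) ⊆ conjV N p Δ s ∧
    compP N p Δ (σ₂.toGam p) ⊆ conjV N p Δ s

/-- `k` is a part of the D-partition of `S(3,1)^open`. -/
def IsDPart (N p Δ : ℕ) [Fact p.Prime] (R₁ R₂ : Set ℤ) (k : Set OpenRep) : Prop :=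
  ∃ σ ∈ SOpen R₁ R₂, k = {σ' | σ' ∈ SOpen R₁ R₂ ∧ DEquiv N p Δ σ σ'}

/-- The irreducible component `T_{p,1}(V)_{I(σ)}` of `T_{p,1}(V)`. -/
noncomputable def compI (N p Δ : ℕ) [Fact p.Prime] (σ : OpenRep) : Set (ShVar (level N)) :=
  proj2 N p '' compP N p Δ (σ.toGam p)

/-- The Shimura subvariety `T_{p,1}(V)_{D(σ)}` of `T_{p,1}(V)`. -/
noncomputable def compD (N p Δ : ℕ) [Fact p.Prime] (σ : OpenRep) : Set (ShVar (level N)) :=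
  proj2 N p '' conjV N p Δ (σ.toGam p)

/-! ### The sets `𝔇_*` and `𝔇_{0,*}` -/

/-- The element `√-Δ` of `ℤ[√-Δ]`. -/
def sqrtNeg (Δ : ℕ) : ℤ√(-(Δ : ℤ)) := Zsqrtd.sqrtd

/-- The matrix `μ₁(σ)` over `ℤ[√-Δ]`. -/
def mu1 (Δ : ℕ) (σ : OpenRep) : Matrix Blk Blk (ℤ√(-(Δ : ℤ))) :=
  fromBlocks (-1) (-(sqrtNeg Δ • σ.Cᵀ.map Int.cast))
    (σ.A.map Int.cast + sqrtNeg Δ • σ.C.map Int.cast)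
    (-1 - sqrtNeg Δ • σ.U.map Int.cast)

/-- The matrix `μ₂(σ)` over `ℤ[√-Δ]`. -/
def mu2 (Δ : ℕ) (σ : OpenRep) : Matrix Blk Blk (ℤ√(-(Δ : ℤ))) :=
  fromBlocks (sqrtNeg Δ • 1) (-(sqrtNeg Δ • σ.Aᵀ.map Int.cast))
    (σ.A.map Int.cast + sqrtNeg Δ • σ.C.map Int.cast)
    (-1 - sqrtNeg Δ • σ.U.map Int.cast)

/-- `𝔇_*`: both determinants vanish in `𝔽_{p²} = ℤ[√-Δ]/p`. -/
def DStar (p Δ : ℕ) (R₁ R₂ : Set ℤ) : Set OpenRep :=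
  {σ | σ ∈ SOpen R₁ R₂ ∧ (p : ℤ√(-(Δ : ℤ))) ∣ (mu1 Δ σ).det ∧
    (p : ℤ√(-(Δ : ℤ))) ∣ (mu2 Δ σ).det}

/-- The isotropic submodule `W_σ ⊆ (A_t)_{p²} = (ℤ/p²)⁶`, spanned by the rows of `σ`. -/
def Wsub (p : ℕ) (σ : OpenRep) : Submodule (ZMod (p ^ 2)) (Idx → ZMod (p ^ 2)) :=
  Submodule.span _ (Set.range (sigmaMat p σ (ZMod (p ^ 2))).row)

/-- The `O_K`-module generated by a submodule of `(ℤ/p²)⁶`; multiplication by `√-Δ` is right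
multiplication of rows by `alpha 0 1`. -/
def OKspan (p Δ : ℕ) (W : Submodule (ZMod (p ^ 2)) (Idx → ZMod (p ^ 2))) :
    Submodule (ZMod (p ^ 2)) (Idx → ZMod (p ^ 2)) :=
  W ⊔ W.map (vecMulLinear (alpha (R := ZMod (p ^ 2)) Δ 0 1))

/-- The invariants of a module `W` over `ℤ/p²`, with `p`-torsion `W_p`, are
`d₁ = dim W/W_p` and `d₂ = dim W_p`; dimensions over `𝔽_p` are read off from cardinalities. -/
def HasInvariants (p : ℕ) (W : Submodule (ZMod (p ^ 2)) (Idx → ZMod (p ^ 2))) (d₁ d₂ : ℕ) :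
    Prop :=
  Nat.card (W ⧸ Submodule.torsionBy (ZMod (p ^ 2)) W (p : ZMod (p ^ 2))) = p ^ d₁ ∧
    Nat.card (Submodule.torsionBy (ZMod (p ^ 2)) W (p : ZMod (p ^ 2))) = p ^ d₂

/-- `𝔇_{0,*}`: the elements of `𝔇_*` for which `O_K W_σ` has invariants `(2, 4)`. -/
def DZeroStar (p Δ : ℕ) (R₁ R₂ : Set ℤ) : Set OpenRep :=
  {σ | σ ∈ DStar p Δ R₁ R₂ ∧ HasInvariants p (OKspan p Δ (Wsub p σ)) 2 4}

end Picard

/-!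
Every assertion is equivalent to one property of `σ`: the lattice `ℤ⁶ σ` is stable under
multiplication by `√-Δ`, that is, `σ ρ σ⁻¹` is integral, where `ρ = alpha Δ 0 1`. By the symplectic
formula for `σ⁻¹` this is the congruence `Stable`: the Gram matrix of the rows of `σ` for the real
part of the Hermitian form vanishes modulo `p²` (the imaginary part does so automatically).

*From the geometry to stability.* In every commutative ring `GU(1,2)` is the centralizer of `ρ` in
`GSp₆`. The domain of `G_V` has a generic point (`exists_generic_point`), given by a reflection in
`(1, t, t²)` with `t` transcendental: a rational similitude which moves it within the domain
commutes with `ρ`. Hence, if the image `[σ z, 1]` of the generic point `z` lies in `V`, then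
`σ` is in `𝒦 · G_V(𝔸_f)`, and `σ ρ σ⁻¹` is conjugate to `ρ` under `𝒦`, hence integral
(`stable_of_forall_mem_subV`). In the same way, if the component of `σ` lies in the subvariety
attached to `s`, then `σ` is stable exactly if `τ s ρ (τ s)⁻¹` is integral, which depends on `s`
only (`stable_iff_of_compP_subset`). So stability is constant on the parts of the D-partition.

*Stability and `𝔇_{0,*}`.* The module `W_σ` always has invariants `(2, 4)`, so `O_K W_σ` has them
exactly if it equals `W_σ` (`hasInvariants_OKspan_iff`). If `σ` is stable then modulo `p` its rows
span a line over `𝔽_{p²}`, because `-Δ` is not a square modulo `p`; this makes the determinants of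
`μ₁(σ)` and `μ₂(σ)` vanish (`Stable.mem_DStar`).

*From stability to the geometry.* One element `β ∈ G_V(ℚ)` of multiplier `p²` satisfies
`σ ∈ Γ β (Γ ∩ G_V(ℚ))` for all stable `σ` (`exists_factorization`). Indeed the middle rows of `σ`
are isotropic modulo `p²`, and an integral unipotent `γ ∈ SU(1,2)`, congruent to the identity modulo
`N` as far as membership in `Γ` needs, moves the isotropic line of `β` to the one they span; then
`σ` and `β γ` generate the same lattice at `p`. The unipotent is explicit, so no strong approximation is
used. The factorization shows that the images of the components of stable `σ` are `V_c` and `V`, and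
that all stable `σ` are D-equivalent. A stable `σ` exists in every `S`, since `Δ (a² + b²) = -1` has
solutions modulo `p²` (`exists_stable`).
-/

namespace Picard

/-! ### Similitudes and multiplication by `√-Δ` -/

section Similitude

variable {R S : Type*} [CommRing R] [CommRing S]

@[simp] theorem toMat_mul (g h : GSp R) : toMat (g * h) = toMat g * toMat h := rfl

@[simp] theorem toMat_one : toMat (1 : GSp R) = 1 := rfl

@[simp] theorem toMat_mk (M : Matrix Idx Idx R) (c : Rˣ)
    (h : M * symJ R * Mᵀ = (c : R) • symJ R) : toMat (GSp.mk M c h) = M := rfl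

theorem toMat_mk_inv (M : Matrix Idx Idx R) (c : Rˣ)
    (h : M * symJ R * Mᵀ = (c : R) • symJ R) :
    toMat (GSp.mk M c h)⁻¹ = -((c⁻¹ : Rˣ) : R) • (symJ R * Mᵀ * symJ R) := rfl

@[simp] theorem toMat_map (f : R →+* S) (g : GSp R) :
    toMat (GSp.map f g) = (toMat g).map f := rfl

theorem toMat_injective : Function.Injective (toMat : GSp R → Matrix Idx Idx R) :=
  fun _ _ h => Subtype.ext (Units.ext h)

@[simp] theorem toMat_mul_inv (g : GSp R) : toMat g * toMat g⁻¹ = 1 := by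
  rw [← toMat_mul, mul_inv_cancel, toMat_one]

@[simp] theorem toMat_inv_mul (g : GSp R) : toMat g⁻¹ * toMat g = 1 := by
  rw [← toMat_mul, inv_mul_cancel, toMat_one]

theorem exists_similitude (g : GSp R) :
    ∃ c : Rˣ, toMat g * symJ R * (toMat g)ᵀ = (c : R) • symJ R := g.2

/-- The inverse of a similitude, by the symplectic formula. -/
theorem toMat_inv_eq (g : GSp R) (c : Rˣ)
    (h : toMat g * symJ R * (toMat g)ᵀ = (c : R) • symJ R) :
    toMat g⁻¹ = -((c⁻¹ : Rˣ) : R) • (symJ R * (toMat g)ᵀ * symJ R) := by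
  have : g = GSp.mk (toMat g) c h := toMat_injective rfl
  conv_lhs => rw [this]
  rw [toMat_mk_inv]

theorem symJ_map (f : R →+* S) : (symJ R).map f = symJ S := by
  simp [symJ, fromBlocks_map, Matrix.map_one, Matrix.map_neg]

theorem hermE_map (f : R →+* S) : (hermE R).map f = hermE S := by
  simp [hermE, fromBlocks_map, Matrix.map_one, Matrix.map_neg]

@[simp] theorem hermE_mul_hermE : hermE R * hermE R = 1 := by
  simp [hermE, fromBlocks_multiply]

theorem hermE_transpose : (hermE R)ᵀ = hermE R := by
  simp [hermE, fromBlocks_transpose]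

theorem hermE_mul_cancel (M : Matrix Blk Blk R) : hermE R * (hermE R * M) = M := by
  rw [← Matrix.mul_assoc, hermE_mul_hermE, Matrix.one_mul]

/-- Right multiplication of rows by `√-Δ`. -/
def rho (Δ : ℕ) (R : Type*) [CommRing R] : Matrix Idx Idx R := alpha Δ 0 1

theorem rho_eq (Δ : ℕ) : rho Δ R = fromBlocks 0 (hermE R) (-((Δ : R) • hermE R)) 0 := by
  simp [rho, alpha]

theorem rho_map (Δ : ℕ) (f : R →+* S) : (rho Δ R).map f = rho Δ S := by
  have : (-((Δ : R) • hermE R)).map f = -((Δ : S) • hermE S) := by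
    rw [← hermE_map f]; ext i j; simp
  rw [rho_eq, rho_eq, fromBlocks_map, hermE_map, this]
  simp

theorem rho_mul_rho (Δ : ℕ) : rho Δ R * rho Δ R = -((Δ : R) • 1) := by
  simp [rho_eq, fromBlocks_multiply, ← fromBlocks_one, fromBlocks_smul, fromBlocks_neg]

theorem rho_mul_symJ (Δ : ℕ) :
    rho Δ R * symJ R = -fromBlocks (hermE R) 0 0 ((Δ : R) • hermE R) := by
  simp [rho_eq, symJ, fromBlocks_multiply, fromBlocks_neg]

theorem alpha_mul_rho (Δ : ℕ) (h k : Matrix Blk Blk R) :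
    alpha Δ h k * rho Δ R = rho Δ R * alpha Δ h k := by
  simp [alpha, rho_eq, fromBlocks_multiply, Matrix.mul_assoc, hermE_mul_cancel]

/-- A matrix commuting with `√-Δ` is of the form `alpha Δ h k`. -/
theorem eq_alpha_of_commute (Δ : ℕ) (M : Matrix Idx Idx R)
    (hM : M * rho Δ R = rho Δ R * M) :
    M = alpha Δ M.toBlocks₁₁ (M.toBlocks₁₂ * hermE R) := by
  rw [← fromBlocks_toBlocks M, rho_eq, fromBlocks_multiply, fromBlocks_multiply,
    fromBlocks_inj] at hM
  obtain ⟨h1, h2, -, -⟩ := hM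
  simp only [Matrix.mul_zero, Matrix.zero_mul, zero_add, add_zero, Matrix.mul_neg,
    Matrix.mul_smul] at h1 h2
  have h3 : M.toBlocks₂₁ = -((Δ : R) • (hermE R * (M.toBlocks₁₂ * hermE R))) := by
    rw [← hermE_mul_cancel M.toBlocks₂₁, ← h1]; simp
  have h4 : M.toBlocks₂₂ = hermE R * M.toBlocks₁₁ * hermE R := by
    rw [Matrix.mul_assoc, h2, hermE_mul_cancel]
  conv_lhs => rw [← fromBlocks_toBlocks M, h3, h4]
  simp [alpha, Matrix.mul_assoc]

theorem alpha_similitude (Δ : ℕ) (h k : Matrix Blk Blk R) :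
    alpha Δ h k * symJ R * (alpha Δ h k)ᵀ =
      fromBlocks (h * hermE R * kᵀ - k * hermE R * hᵀ)
        ((h * hermE R * hᵀ + (Δ : R) • (k * hermE R * kᵀ)) * hermE R)
        (-(hermE R * (h * hermE R * hᵀ + (Δ : R) • (k * hermE R * kᵀ))))
        ((Δ : R) • (hermE R * (h * hermE R * kᵀ - k * hermE R * hᵀ) * hermE R)) := by
  simp only [alpha, symJ, fromBlocks_multiply, fromBlocks_transpose, fromBlocks_inj,
    transpose_mul, transpose_neg, transpose_smul, hermE_transpose, Matrix.mul_zero,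
    Matrix.mul_one, Matrix.mul_neg, Matrix.neg_mul, Matrix.mul_smul, Matrix.smul_mul, zero_add,
    add_zero, Matrix.mul_assoc, Matrix.mul_add, Matrix.add_mul, Matrix.mul_sub,
    Matrix.sub_mul, smul_sub, smul_neg]
  refine ⟨by abel, by abel, by abel, by abel⟩

/-- `G_V` is the centralizer of `√-Δ` in the group of symplectic similitudes. -/
theorem mem_GV_iff (Δ : ℕ) (g : GSp R) :
    g ∈ GV Δ R ↔ toMat g * rho Δ R = rho Δ R * toMat g := by
  constructor
  · rintro ⟨h, k, c, hg, -, -⟩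
    rw [hg, alpha_mul_rho]
  · intro hg
    obtain ⟨c, hc⟩ := exists_similitude g
    have hα := eq_alpha_of_commute Δ _ hg
    refine ⟨_, _, c, hα, ?_⟩
    generalize (toMat g).toBlocks₁₁ = h at *
    generalize (toMat g).toBlocks₁₂ * hermE R = k at *
    rw [hα, alpha_similitude, symJ, fromBlocks_smul, fromBlocks_inj] at hc
    obtain ⟨h1, h2, -, -⟩ := hc
    constructor
    · have := congrArg (· * hermE R) h2
      simpa [Matrix.mul_assoc] using this
    · rw [smul_zero, sub_eq_zero] at h1
      exact h1.symm

theorem mul_mem_GV {Δ : ℕ} {g h : GSp R} (hg : g ∈ GV Δ R) (hh : h ∈ GV Δ R) :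
    g * h ∈ GV Δ R := by
  rw [mem_GV_iff] at *
  rw [toMat_mul, Matrix.mul_assoc, hh, ← Matrix.mul_assoc, hg, Matrix.mul_assoc]

theorem one_mem_GV (Δ : ℕ) : (1 : GSp R) ∈ GV Δ R := by
  rw [mem_GV_iff]; simp

theorem inv_mem_GV {Δ : ℕ} {g : GSp R} (hg : g ∈ GV Δ R) : g⁻¹ ∈ GV Δ R := by
  rw [mem_GV_iff] at *
  have := congrArg (fun M => toMat g⁻¹ * M * toMat g⁻¹) hg
  simp only [← Matrix.mul_assoc, toMat_inv_mul, Matrix.one_mul] at this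
  rw [this]
  simp [Matrix.mul_assoc]

theorem map_mem_GV {Δ : ℕ} (f : R →+* S) {g : GSp R} (hg : g ∈ GV Δ R) :
    GSp.map f g ∈ GV Δ S := by
  rw [mem_GV_iff] at *
  rw [toMat_map, ← rho_map Δ f, ← Matrix.map_mul, hg, Matrix.map_mul]

end Similitude

/-! ### Integral adeles and level subgroups -/

/-- The integral finite adeles as a subring. -/
def integralAdeles : Subring Af where
  carrier := {x | IsIntegralAdele x}
  mul_mem' ha hb v := mul_mem (ha v) (hb v)
  one_mem' _ := one_mem _
  add_mem' ha hb v := add_mem (ha v) (hb v)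
  zero_mem' _ := zero_mem _
  neg_mem' ha v := neg_mem (ha v)

theorem algebraMap_intCast_mem (n : ℤ) : algebraMap ℚ Af n ∈ integralAdeles := by
  rw [map_intCast]
  exact intCast_mem _ n

/-- A rational number that is an integral adele is an integer. -/
theorem exists_int_of_mem_integralAdeles (x : ℚ) (hx : algebraMap ℚ Af x ∈ integralAdeles) :
    ∃ n : ℤ, (n : ℚ) = x := by
  have := IsDedekindDomain.HeightOneSpectrum.mem_integers_of_valuation_le_one (R := ℤ) ℚ x
    (fun v => by
      have h := hx v
      rw [IsDedekindDomain.FiniteAdeleRing.algebraMap_apply,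
        IsDedekindDomain.HeightOneSpectrum.mem_adicCompletionIntegers,
        IsDedekindDomain.HeightOneSpectrum.valuedAdicCompletion_eq_valuation'] at h
      exact h)
  obtain ⟨n, hn⟩ := this
  exact ⟨n, by simpa using hn⟩

/-- All entries of an adelic matrix are integral. -/
def IsIntegralMat (M : Matrix Idx Idx Af) : Prop := ∀ i j, M i j ∈ integralAdeles

theorem IsIntegralMat.mul {M M' : Matrix Idx Idx Af} (h : IsIntegralMat M)
    (h' : IsIntegralMat M') : IsIntegralMat (M * M') := fun i j => by
  rw [Matrix.mul_apply]
  exact sum_mem fun k _ => mul_mem (h i k) (h' k j)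

theorem isIntegralMat_map_intCast (M : Matrix Idx Idx ℤ) :
    IsIntegralMat (M.map (Int.castRingHom Af)) := fun i j => by
  simp [intCast_mem]

/-- The level subgroup `𝒦` as a subgroup. -/
def levelSubgroup (N : ℕ) : Subgroup (GSp Af) where
  carrier := level N
  one_mem' := by
    have h1 : IsIntegralMat (1 : Matrix Idx Idx Af) := by
      simpa [Matrix.map_one] using isIntegralMat_map_intCast 1
    exact ⟨h1, by rw [inv_one]; exact h1, fun i j => ⟨0, zero_mem integralAdeles, by simp⟩⟩
  mul_mem' := by
    rintro a b ⟨ha, ha', ha''⟩ ⟨hb, hb', hb''⟩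
    refine ⟨IsIntegralMat.mul ha hb, ?_, fun i j => ?_⟩
    · rw [_root_.mul_inv_rev]
      exact IsIntegralMat.mul hb' ha'
    · choose y hy hy' using ha''
      choose z hz hz' using hb''
      refine ⟨∑ k, y i k * toMat b (Sum.inl k) (Sum.inl j) +
        ∑ k, toMat a (Sum.inr i) (Sum.inr k) * z k j,
        add_mem (S := Subring Af) (s := integralAdeles)
          (sum_mem fun k _ => mul_mem (hy i k) (hb _ _))
          (sum_mem fun k _ => mul_mem (ha _ _) (hz k j)), ?_⟩
      rw [toMat_mul, Matrix.mul_apply, Fintype.sum_sum_type, mul_add, Finset.mul_sum,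
        Finset.mul_sum]
      congr 1
      · exact Finset.sum_congr rfl fun k _ => by rw [hy']; ring
      · exact Finset.sum_congr rfl fun k _ => by rw [hz']; ring
  inv_mem' := by
    rintro g ⟨hg, hg', hg''⟩
    refine ⟨hg', by rw [inv_inv]; exact hg, fun i j => ?_⟩
    obtain ⟨c, hc⟩ := exists_similitude g
    have hc' : toMat g⁻¹ * symJ Af * (toMat g⁻¹)ᵀ = ((c⁻¹ : Afˣ) : Af) • symJ Af := by
      have h1 : symJ Af = ((c⁻¹ : Afˣ) : Af) • (toMat g * symJ Af * (toMat g)ᵀ) := by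
        rw [hc, smul_smul, Units.inv_mul, one_smul]
      have h2 : (toMat g)ᵀ * (toMat g⁻¹)ᵀ = 1 := by
        rw [← transpose_mul, toMat_inv_mul, transpose_one]
      conv_lhs => rw [h1]
      rw [Matrix.mul_smul, Matrix.smul_mul, Matrix.mul_assoc, Matrix.mul_assoc, h2,
        Matrix.mul_one, ← Matrix.mul_assoc, toMat_inv_mul, Matrix.one_mul]
    have hJ : IsIntegralMat (symJ Af) := by
      rw [← symJ_map (Int.castRingHom Af)]; exact isIntegralMat_map_intCast _
    -- the multiplier of an integral similitude with integral inverse is an integral unit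
    have hcint : ((c⁻¹ : Afˣ) : Af) ∈ integralAdeles := by
      have h := (IsIntegralMat.mul (IsIntegralMat.mul hg' hJ)
        (M' := (toMat g⁻¹)ᵀ) fun i j => hg' j i) (Sum.inl (Sum.inl 0)) (Sum.inr (Sum.inl 0))
      rw [hc'] at h
      simpa [symJ] using h
    obtain ⟨y, hy, hy'⟩ := hg'' j i
    refine ⟨-((c⁻¹ : Afˣ) : Af) * y, mul_mem (neg_mem hcint) hy, ?_⟩
    rw [toMat_inv_eq g c hc, ← fromBlocks_toBlocks (toMat g), symJ, fromBlocks_transpose,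
      fromBlocks_multiply, fromBlocks_multiply]
    simp [toBlocks₂₁, hy']
    ring

/-- The level subgroup `𝒦_p` as a subgroup. -/
noncomputable def levelPSubgroup (N p : ℕ) [Fact p.Prime] : Subgroup (GSp Af) :=
  levelSubgroup N ⊓ (levelSubgroup N).comap (MulAut.conj (diagA (tau p))).toMonoidHom

/-- `Γ` as a subgroup. -/
noncomputable def gamSubgroup (N : ℕ) : Subgroup (GSp ℚ) := (levelSubgroup N).comap diagA

/-- Integral symplectic matrices with lower left block divisible by `N` lie in `Γ`. -/
theorem mem_Gam_of_int {N : ℕ} {q : GSp ℚ} {M : Matrix Idx Idx ℤ}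
    (hq : toMat q = M.map (Int.castRingHom ℚ)) (hM : M * symJ ℤ * Mᵀ = symJ ℤ)
    (hN : ∀ i j : Blk, (N : ℤ) ∣ M (Sum.inr i) (Sum.inl j)) : q ∈ gamSubgroup N := by
  have hcomp : ∀ L : Matrix Idx Idx ℤ, (L.map (Int.castRingHom ℚ)).map (algebraMap ℚ Af) =
      L.map (Int.castRingHom Af) := fun L => by ext i j; simp
  have h1 : toMat q * symJ ℚ * (toMat q)ᵀ = ((1 : ℚˣ) : ℚ) • symJ ℚ := by
    rw [hq, ← symJ_map (Int.castRingHom ℚ), ← transpose_map, ← Matrix.map_mul, ← Matrix.map_mul,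
      hM, Units.val_one, one_smul]
  have h2 : toMat q⁻¹ = (-(symJ ℤ * Mᵀ * symJ ℤ)).map (Int.castRingHom ℚ) := by
    rw [toMat_inv_eq q 1 h1, hq, ← symJ_map (Int.castRingHom ℚ), ← transpose_map,
      ← Matrix.map_mul, ← Matrix.map_mul]
    ext i j
    simp
  refine ⟨?_, ?_, fun i j => ?_⟩
  · change IsIntegralMat ((toMat q).map (algebraMap ℚ Af))
    rw [hq, hcomp]
    exact isIntegralMat_map_intCast _
  · change IsIntegralMat ((toMat q⁻¹).map (algebraMap ℚ Af))
    rw [h2, hcomp]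
    exact isIntegralMat_map_intCast _
  · obtain ⟨m, hm⟩ := hN i j
    refine ⟨m, intCast_mem integralAdeles m, ?_⟩
    change ((toMat q).map (algebraMap ℚ Af)) (Sum.inr i) (Sum.inl j) = _
    rw [hq, hcomp]
    simp [hm]

/-! ### Points of the Shimura varieties -/

@[simp] theorem act_one (z : Dom) : act 1 z = z := by
  apply Subtype.ext; simp [act]

theorem act_mul (a b : GSp ℚ) (z : Dom) : act (a * b) z = act a (act b z) := by
  apply Subtype.ext; simp only [act, map_mul]; group

/-- Two pairs give the same point exactly if a rational element and an element of the level
subgroup relate them. -/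
theorem pt_eq_pt_iff (K : Subgroup (GSp Af)) (z z' : Dom) (g g' : GSp Af) :
    pt (K : Set (GSp Af)) z g = pt K z' g' ↔
      ∃ q : GSp ℚ, ∃ k ∈ K, z' = act q z ∧ g' = k * g * (diagA q)⁻¹ := by
  have heq : Equivalence (shRel (K : Set (GSp Af))) := by
    refine ⟨fun x => ⟨1, 1, K.one_mem, by simp, by simp⟩, ?_, ?_⟩
    · rintro x y ⟨q, k, hk, h1, h2⟩
      refine ⟨q⁻¹, k⁻¹, K.inv_mem hk, ?_, ?_⟩
      · rw [h1, ← act_mul, inv_mul_cancel, act_one]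
      · rw [h2, map_inv]; group
    · rintro x y w ⟨q, k, hk, h1, h2⟩ ⟨q', k', hk', h1', h2'⟩
      refine ⟨q' * q, k' * k, K.mul_mem hk' hk, ?_, ?_⟩
      · rw [h1', h1, act_mul]
      · rw [h2', h2, map_mul]; group
  exact Quot.eq.trans (by rw [heq.eqvGen_iff]; rfl)

theorem DomV_act {Δ : ℕ} {q : GSp ℚ} (hq : q ∈ GV Δ ℚ) {z : Dom} (hz : z ∈ DomV Δ) :
    act q z ∈ DomV Δ := by
  obtain ⟨g, hg, hz⟩ := hz
  refine ⟨_, mul_mem_GV (map_mem_GV (algebraMap ℚ ℝ) hq) hg, ?_⟩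
  simp only [act, toMat_mul, _root_.mul_inv_rev, hz, Matrix.mul_assoc]

/-! ### A Hodge-generic point of the subdomain -/

section Generic

variable {R S : Type*} [CommRing R] [CommRing S]

/-- The vector `(1, t, t²)`. -/
def momentVec (t : R) : Blk → R := Sum.elim (fun _ => 1) ![t, t ^ 2]

/-- The value of the Hermitian form at `(1, t, t²)`. -/
def momentNorm (t : R) : R := 1 - t ^ 2 - t ^ 4

/-- The reflection in `(1, t, t²)` with respect to `E`, multiplied by the value of the form there,
so that its entries are polynomials in `t`. -/
def reflect (t : R) : Matrix Blk Blk R :=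
  momentNorm t • 1 - (2 : R) • (vecMulVec (momentVec t) (momentVec t) * hermE R)

theorem reflect_transpose (t : R) : (reflect t)ᵀ = hermE R * reflect t * hermE R := by
  simp [reflect, transpose_mul, hermE_transpose, transpose_vecMulVec, Matrix.sub_mul,
    Matrix.mul_sub, Matrix.mul_assoc]

theorem reflect_mul_reflect (t : R) : reflect t * reflect t = (momentNorm t) ^ 2 • 1 := by
  have hw : momentVec t ᵥ* hermE R ⬝ᵥ momentVec t = momentNorm t := by
    simp [momentVec, momentNorm, hermE, vecMul, dotProduct, Fintype.sum_sum_type,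
      Matrix.one_apply]
    ring
  have h1 : vecMulVec (momentVec t) (momentVec t) * hermE R *
      (vecMulVec (momentVec t) (momentVec t) * hermE R) =
        momentNorm t • (vecMulVec (momentVec t) (momentVec t) * hermE R) := by
    rw [← Matrix.mul_assoc, Matrix.vecMulVec_mul, vecMulVec_mul_vecMulVec, hw, vecMulVec_smul,
      Matrix.smul_mul, Matrix.vecMulVec_mul]
  rw [reflect]
  generalize vecMulVec (momentVec t) (momentVec t) * hermE R = P at *
  simp only [Matrix.sub_mul, Matrix.mul_sub, Matrix.smul_mul, Matrix.mul_smul, Matrix.one_mul,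
    Matrix.mul_one, h1]
  module

/-- A polynomial multiple of the value at `i` of the point of the subdomain which the reflection
in `(1, t, t²)` defines. -/
def hodgePoly (Δ : ℕ) (t : R) : Matrix Idx Idx R :=
  fromBlocks 0 (reflect t * (reflect t)ᵀ)
    (-((Δ : R) • (hermE R * (reflect t * (reflect t)ᵀ) * hermE R))) 0

theorem hodgePoly_map (Δ : ℕ) (f : R →+* S) (t : R) :
    (hodgePoly Δ t).map f = hodgePoly Δ (f t) := by
  have hP : (vecMulVec (momentVec t) (momentVec t)).map f =
      vecMulVec (momentVec (f t)) (momentVec (f t)) := by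
    ext (i | i) (j | j) <;> fin_cases i <;> fin_cases j <;> simp [momentVec, vecMulVec_apply]
  have h1 : (reflect t).map f = reflect (f t) := by
    rw [reflect, reflect, ← hP, ← hermE_map f, ← Matrix.map_mul]
    ext i j
    simp only [Matrix.map_apply, Matrix.sub_apply, Matrix.smul_apply, map_sub, smul_eq_mul,
      map_mul, map_ofNat, Matrix.one_apply, momentNorm, map_pow, map_one, apply_ite f, map_zero]
  have h2 : (reflect t * (reflect t)ᵀ).map f = reflect (f t) * (reflect (f t))ᵀ := by
    rw [Matrix.map_mul, transpose_map, h1]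
  have h3 : (-((Δ : R) • (hermE R * (reflect t * (reflect t)ᵀ) * hermE R))).map f =
      -((Δ : S) • (hermE S * (reflect (f t) * (reflect (f t))ᵀ) * hermE S)) := by
    rw [← h2, ← hermE_map f, ← Matrix.map_mul, ← Matrix.map_mul]
    ext i j
    simp only [Matrix.map_apply, Matrix.neg_apply, Matrix.smul_apply, smul_eq_mul, map_neg,
      map_mul, map_natCast]
  rw [hodgePoly, hodgePoly, fromBlocks_map, h2, h3]
  simp

/-- Commuting with the Hodge structure at a transcendental parameter is a polynomial identity. -/
theorem commute_hodgePoly_of_transcendental {Δ : ℕ} {t : ℝ} (ht : Transcendental ℚ t)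
    {M : Matrix Idx Idx ℚ}
    (hM : M.map (algebraMap ℚ ℝ) * hodgePoly Δ t = hodgePoly Δ t * M.map (algebraMap ℚ ℝ))
    (u : ℚ) : M * hodgePoly Δ u = hodgePoly Δ u * M := by
  let D : Matrix Idx Idx (Polynomial ℚ) :=
    M.map Polynomial.C * hodgePoly Δ Polynomial.X - hodgePoly Δ Polynomial.X * M.map Polynomial.C
  have hmap : ∀ {A : Type} [CommRing A] [Algebra ℚ A] (x : A),
      D.map (Polynomial.aeval x) = M.map (algebraMap ℚ A) * hodgePoly Δ x -
        hodgePoly Δ x * M.map (algebraMap ℚ A) := by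
    intro A _ _ x
    have hC : (M.map Polynomial.C).map (Polynomial.aeval x : Polynomial ℚ →ₐ[ℚ] A) =
        M.map (algebraMap ℚ A) := by ext i j; simp
    have hX : (hodgePoly Δ (Polynomial.X : Polynomial ℚ)).map
        (Polynomial.aeval x : Polynomial ℚ →ₐ[ℚ] A) = hodgePoly Δ x := by
      have := hodgePoly_map Δ (Polynomial.aeval x : Polynomial ℚ →ₐ[ℚ] A).toRingHom
        (Polynomial.X : Polynomial ℚ)
      simpa using this
    rw [← hC, ← hX, ← Matrix.map_mul, ← Matrix.map_mul]
    ext i j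
    simp only [D, Matrix.map_apply, Matrix.sub_apply, map_sub]
  have hD : D = 0 := by
    ext1 i j
    have h0 := congrFun (congrFun (hmap t) i) j
    rw [hM, sub_self] at h0
    by_contra hne
    exact ht ⟨D i j, hne, h0⟩
  have := hmap u
  rw [hD] at this
  have h2 : M.map (algebraMap ℚ ℚ) = M := by ext i j; simp
  rw [h2] at this
  have h0 : (0 : Matrix Idx Idx (Polynomial ℚ)).map (Polynomial.aeval u) =
      (0 : Matrix Idx Idx ℚ) := by
    ext i j; simp
  rw [h0] at this
  exact (sub_eq_zero.mp this.symm)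

theorem reflect_mul_transpose_apply (t : R) : reflect t * (reflect t)ᵀ =
    fromBlocks !![(1 + t ^ 2 + t ^ 4) ^ 2 + 4 * t ^ 2 + 4 * t ^ 4]
      !![4 * t * (1 + t ^ 2 + t ^ 4), 4 * t ^ 2 * (1 + t ^ 2 + t ^ 4)]
      !![4 * t * (1 + t ^ 2 + t ^ 4); 4 * t ^ 2 * (1 + t ^ 2 + t ^ 4)]
      !![8 * t ^ 2 + (momentNorm t) ^ 2, 8 * t ^ 3; 8 * t ^ 3, 8 * t ^ 4 + (momentNorm t) ^ 2] := by
  ext (i | i) (j | j) <;> fin_cases i <;> fin_cases j <;>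
    simp [Matrix.mul_apply, Fintype.sum_sum_type, reflect, momentVec, hermE, vecMulVec_apply,
      momentNorm, Matrix.one_apply] <;> ring

/-- The matrices `R Rᵀ`, where `R` runs over the rational reflections, are centralized by scalars
only. -/
theorem exists_scalar_of_commute_reflect (a : Matrix Blk Blk ℚ)
    (h : ∀ u : ℚ, a * (reflect u * (reflect u)ᵀ) = reflect u * (reflect u)ᵀ * a) :
    ∃ x : ℚ, a = x • 1 := by
  have key : ∀ (u : ℚ) (i j : Blk), (a * (reflect u * (reflect u)ᵀ)) i j =
      (reflect u * (reflect u)ᵀ * a) i j := fun u i j => by rw [h u]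
  simp only [reflect_mul_transpose_apply, Matrix.mul_apply, Fintype.sum_sum_type,
    Fin.sum_univ_two, Finset.univ_unique, Finset.sum_singleton, momentNorm] at key
  refine ⟨a (Sum.inl 0) (Sum.inl 0), ?_⟩
  have h11 := fun u => key u (Sum.inl 0) (Sum.inl 0)
  have h12 := fun u => key u (Sum.inl 0) (Sum.inr 0)
  have h13 := fun u => key u (Sum.inl 0) (Sum.inr 1)
  have h21 := fun u => key u (Sum.inr 0) (Sum.inl 0)
  have h22 := fun u => key u (Sum.inr 0) (Sum.inr 0)
  have h31 := fun u => key u (Sum.inr 1) (Sum.inl 0)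
  clear key h
  simp [-Fin.isValue] at h11 h12 h13 h21 h22 h31
  -- polynomial identities in `u`: the values at `±1`, `±2` give enough linear equations
  have e11 := And.intro (h11 1) (And.intro (h11 (-1)) (And.intro (h11 2) (h11 (-2))))
  have e12 := And.intro (h12 1) (And.intro (h12 (-1)) (And.intro (h12 2) (h12 (-2))))
  have e13 := And.intro (h13 1) (And.intro (h13 (-1)) (And.intro (h13 2) (h13 (-2))))
  have e21 := And.intro (h21 1) (And.intro (h21 (-1)) (And.intro (h21 2) (h21 (-2))))
  have e31 := And.intro (h31 1) (And.intro (h31 (-1)) (And.intro (h31 2) (h31 (-2))))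
  have e22 := And.intro (h22 1) (And.intro (h22 (-1)) (And.intro (h22 2) (h22 (-2))))
  clear h11 h12 h13 h21 h22 h31
  norm_num at e11 e12 e13 e21 e22 e31
  obtain ⟨a1, a2, a3, a4⟩ := e11
  obtain ⟨b1, b2, b3, b4⟩ := e12
  obtain ⟨c1, c2, c3, c4⟩ := e13
  obtain ⟨d1, d2, d3, d4⟩ := e21
  obtain ⟨f1, f2, f3, f4⟩ := e31
  obtain ⟨g1, g2, g3, g4⟩ := e22
  ext (i | i) (j | j) <;> fin_cases i <;> fin_cases j <;> simp [-Fin.isValue] <;> linarith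

/-- A rational endomorphism of the generic Hodge structure lies in `K`. -/
theorem exists_of_commute_hodgePoly {Δ : ℕ} (hΔ : 0 < Δ) (M : Matrix Idx Idx ℚ)
    (hM : ∀ u : ℚ, M * hodgePoly Δ u = hodgePoly Δ u * M) :
    ∃ x y : ℚ, M = x • 1 + y • rho Δ ℚ := by
  have hΔ' : (Δ : ℚ) ≠ 0 := by exact_mod_cast hΔ.ne'
  obtain ⟨a, b, c, d, rfl⟩ : ∃ a b c d, M = fromBlocks a b c d :=
    ⟨_, _, _, _, (fromBlocks_toBlocks M).symm⟩
  simp only [hodgePoly, fromBlocks_multiply, fromBlocks_inj, Matrix.mul_zero, Matrix.zero_mul,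
    zero_add, add_zero, Matrix.mul_neg, Matrix.neg_mul, Matrix.mul_smul, Matrix.smul_mul] at hM
  have hB0 : reflect (0 : ℚ) * (reflect (0 : ℚ))ᵀ = 1 := by
    rw [reflect_mul_transpose_apply]
    ext (i | i) (j | j) <;> fin_cases i <;> fin_cases j <;> simp [momentNorm]
  -- the parameter `0` is the base point; it determines two of the four blocks
  obtain ⟨h1, h2, -, -⟩ := hM 0
  simp only [hB0, Matrix.mul_one, Matrix.one_mul, hermE_mul_hermE] at h1 h2
  subst h1 h2
  obtain ⟨x, hx⟩ := exists_scalar_of_commute_reflect a fun u => (hM u).2.1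
  obtain ⟨y, hy⟩ := exists_scalar_of_commute_reflect (b * hermE ℚ) fun u => by
    have h := (hM u).1
    rw [Matrix.mul_neg, Matrix.mul_smul, neg_inj] at h
    have h' := congrArg (· * hermE ℚ) (smul_right_injective _ hΔ' h)
    simpa only [Matrix.mul_assoc, hermE_mul_hermE, Matrix.mul_one] using h'
  have hb : b = y • hermE ℚ := by
    have h' := congrArg (· * hermE ℚ) hy
    simpa [Matrix.mul_assoc] using h'
  refine ⟨x, y, ?_⟩
  rw [hx, hb, rho_eq, ← fromBlocks_one (l := Blk) (m := Blk), fromBlocks_smul, fromBlocks_smul,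
    fromBlocks_add]
  simp [smul_smul, mul_comm]

end Generic

theorem hV_eq (Δ : ℕ) (hΔ : 0 < Δ) :
    hV Δ = fromBlocks 0 ((Real.sqrt Δ)⁻¹ • 1) (-(Real.sqrt Δ • 1)) 0 := by
  have h1 : (Δ : ℝ) * (Real.sqrt Δ)⁻¹ = Real.sqrt Δ := by
    have h0 : Real.sqrt Δ ≠ 0 := by positivity
    field_simp
    exact (Real.sq_sqrt (by positivity)).symm
  simp [hV, alpha, smul_smul, h1]

theorem DomV_commute_rho {Δ : ℕ} {z : Dom} (hz : z ∈ DomV Δ) :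
    toMat z.1 * rho Δ ℝ = rho Δ ℝ * toMat z.1 := by
  obtain ⟨g, hg, hz⟩ := hz
  rw [hz, Matrix.mul_assoc, (mem_GV_iff Δ _).mp (inv_mem_GV hg), Matrix.mul_assoc,
    ← Matrix.mul_assoc (hV Δ), hV, alpha_mul_rho, ← Matrix.mul_assoc, ← Matrix.mul_assoc,
    (mem_GV_iff Δ _).mp hg]
  simp only [Matrix.mul_assoc]

/-- The trace that records the signature of the Hermitian form on the subdomain. -/
theorem DomV_trace {Δ : ℕ} (hΔ : 0 < Δ) {z : Dom} (hz : z ∈ DomV Δ) :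
    (toMat z.1 * rho Δ ℝ).trace = 2 * Real.sqrt Δ := by
  obtain ⟨g, hg, hz⟩ := hz
  rw [hz, Matrix.mul_assoc, (mem_GV_iff Δ _).mp (inv_mem_GV hg), ← Matrix.mul_assoc,
    Matrix.trace_mul_comm, ← Matrix.mul_assoc, ← Matrix.mul_assoc, toMat_inv_mul, Matrix.one_mul,
    hV_eq Δ hΔ, rho_eq, fromBlocks_multiply]
  have h0 : Real.sqrt Δ ≠ 0 := by positivity
  have h1 : (Δ : ℝ) = Real.sqrt Δ * Real.sqrt Δ := (Real.mul_self_sqrt (by positivity)).symm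
  have h2 : (hermE ℝ).trace = -1 := by
    simp [hermE, Matrix.trace, Fintype.sum_sum_type]; norm_num
  have h3 : ∀ A B C D : Matrix Blk Blk ℝ, (fromBlocks A B C D).trace = A.trace + D.trace :=
    fun A B C D => by simp [Matrix.trace, Fintype.sum_sum_type]
  rw [h3]
  simp only [Matrix.zero_mul, Matrix.mul_neg, Matrix.neg_mul, Matrix.smul_mul, Matrix.mul_smul,
    Matrix.one_mul, zero_add, add_zero, smul_smul, Matrix.trace_neg, Matrix.trace_smul, h2,
    smul_eq_mul]
  field_simp
  linear_combination h1

/-- There is a point of the subdomain whose Hodge structure is so generic that every rational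
similitude moving it within the subdomain commutes with `√-Δ`. -/
theorem exists_generic_point {Δ : ℕ} (hΔ : 0 < Δ) :
    ∃ z ∈ DomV Δ, ∀ β : GSp ℚ, act β z ∈ DomV Δ → toMat β * rho Δ ℚ = rho Δ ℚ * toMat β := by
  obtain ⟨t, ht⟩ : ∃ t : ℝ, Transcendental ℚ t :=
    ⟨liouvilleNumber 2, fun h => transcendental_liouvilleNumber le_rfl
      ((IsFractionRing.isAlgebraic_iff ℤ ℚ ℝ).mpr h)⟩
  have hs : Real.sqrt Δ ≠ 0 := by positivity
  have hQ : momentNorm t ≠ 0 := by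
    intro h0
    refine ht ⟨1 - Polynomial.X ^ 2 - Polynomial.X ^ 4, fun h => ?_, by simpa [momentNorm] using h0⟩
    have := congrArg (Polynomial.eval 0) h
    simp at this
  let g : GSp ℝ := GSp.mk (alpha Δ (reflect t) 0) (Units.mk0 (momentNorm t ^ 2) (by positivity)) (by
    have h : reflect t * hermE ℝ * (reflect t)ᵀ = momentNorm t ^ 2 • hermE ℝ := by
      rw [reflect_transpose, Matrix.mul_assoc, Matrix.mul_assoc, hermE_mul_cancel,
        ← Matrix.mul_assoc, reflect_mul_reflect, Matrix.smul_mul, Matrix.one_mul]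
    rw [alpha_similitude, h, symJ, fromBlocks_smul]
    simp)
  let d : GSp ℝ := GSp.mk (fromBlocks 1 0 0 (Real.sqrt Δ • 1)) (Units.mk0 (Real.sqrt Δ) hs) (by
    simp [symJ, fromBlocks_multiply, fromBlocks_transpose, fromBlocks_smul])
  have hg : g ∈ GV Δ ℝ := by
    rw [mem_GV_iff]; exact alpha_mul_rho _ _ _
  have hd : toMat d * symJ ℝ * toMat d⁻¹ = hV Δ := by
    have h : toMat d * symJ ℝ = hV Δ * toMat d := by
      rw [hV_eq Δ hΔ, toMat_mk]
      simp [symJ, fromBlocks_multiply, smul_smul, hs]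
    rw [h, Matrix.mul_assoc, toMat_mul_inv, Matrix.mul_one]
  let z : Dom := ⟨_, g * d, rfl⟩
  have hz : toMat z.1 = toMat g * hV Δ * toMat g⁻¹ := by
    simp only [z, toMat_mul, _root_.mul_inv_rev, toMat_mk, ← hd, Matrix.mul_assoc]
  have hzV : z ∈ DomV Δ := ⟨g, hg, hz⟩
  have hpoly : hodgePoly Δ t = (momentNorm t ^ 2 * Real.sqrt Δ) • toMat z.1 := by
    have h : hodgePoly Δ t * toMat g = (momentNorm t ^ 2 * Real.sqrt Δ) • (toMat g * hV Δ) := by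
      have h1 : (Real.sqrt Δ) * Real.sqrt Δ = Δ := Real.mul_self_sqrt (by positivity)
      rw [hV_eq Δ hΔ, toMat_mk]
      simp only [hodgePoly, alpha, reflect_transpose, fromBlocks_multiply, fromBlocks_smul,
        fromBlocks_inj, Matrix.mul_assoc, hermE_mul_cancel, hermE_mul_hermE, Matrix.mul_one,
        Matrix.mul_zero, Matrix.zero_mul, zero_add, add_zero, Matrix.neg_mul, Matrix.mul_neg,
        Matrix.smul_mul, Matrix.mul_smul, smul_zero, neg_zero]
      have h2 : reflect t * (reflect t * hermE ℝ) = momentNorm t ^ 2 • hermE ℝ := by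
        rw [← Matrix.mul_assoc, reflect_mul_reflect, Matrix.smul_mul, Matrix.one_mul]
      refine ⟨trivial, ?_, ?_, trivial⟩
      · rw [h2]
        simp [smul_smul, hs]
      · rw [reflect_mul_reflect]
        simp only [Matrix.mul_smul, Matrix.mul_one, smul_smul, smul_neg]
        congr 2
        linear_combination (-momentNorm t ^ 2) * h1
    have h' := congrArg (· * toMat g⁻¹) h
    simp only [Matrix.mul_assoc, toMat_mul_inv, Matrix.mul_one, Matrix.smul_mul] at h'
    rw [h', hz, Matrix.mul_assoc]
  refine ⟨z, hzV, fun β hβ => ?_⟩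
  set b := toMat (GSp.map (algebraMap ℚ ℝ) β) with hb
  set b' := toMat (GSp.map (algebraMap ℚ ℝ) β)⁻¹ with hb'
  have hbb' : b * b' = 1 := toMat_mul_inv _
  have hb'b : b' * b = 1 := toMat_inv_mul _
  have hact : toMat (act β z).1 = b * toMat z.1 * b' := rfl
  -- `β⁻¹ √-Δ β` commutes with `z`, since `√-Δ` commutes with `β z`
  set M := toMat β⁻¹ * rho Δ ℚ * toMat β with hM
  have hMR : M.map (algebraMap ℚ ℝ) = b' * rho Δ ℝ * b := by
    rw [hM, Matrix.map_mul, Matrix.map_mul, rho_map, hb', ← map_inv]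
    rfl
  have hcomm := DomV_commute_rho hβ
  rw [hact] at hcomm
  have hMz : M.map (algebraMap ℚ ℝ) * toMat z.1 = toMat z.1 * M.map (algebraMap ℚ ℝ) := by
    rw [hMR]
    have h := congrArg (fun L => b' * L * b) hcomm
    simp only [Matrix.mul_assoc] at h ⊢
    rw [hb'b, Matrix.mul_one, ← Matrix.mul_assoc b' b, hb'b, Matrix.one_mul] at h
    exact h.symm
  obtain ⟨x, y, hxy⟩ := exists_of_commute_hodgePoly hΔ M
    (commute_hodgePoly_of_transcendental ht (by
      rw [hpoly, Matrix.mul_smul, Matrix.smul_mul, hMz]))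
  have hsq : M * M = -((Δ : ℚ) • 1) := by
    have : M * M = toMat β⁻¹ * (rho Δ ℚ * ((toMat β * toMat β⁻¹) * rho Δ ℚ)) * toMat β := by
      rw [hM]; simp only [Matrix.mul_assoc]
    rw [this, toMat_mul_inv, Matrix.one_mul, rho_mul_rho]
    simp
  have hsq' : M * M = (x ^ 2 - Δ * y ^ 2) • 1 + (2 * x * y) • rho Δ ℚ := by
    rw [hxy]
    simp only [Matrix.add_mul, Matrix.mul_add, Matrix.smul_mul, Matrix.mul_smul, Matrix.one_mul,
      Matrix.mul_one, rho_mul_rho]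
    module
  rw [hsq'] at hsq
  have e1 := congrFun (congrFun hsq (Sum.inl (Sum.inl 0))) (Sum.inl (Sum.inl 0))
  have e2 := congrFun (congrFun hsq (Sum.inl (Sum.inl 0))) (Sum.inr (Sum.inl 0))
  simp [rho_eq, hermE] at e1 e2
  have hΔ' : (0 : ℚ) < Δ := by exact_mod_cast hΔ
  have hy0 : y ≠ 0 := by
    rintro rfl
    nlinarith [sq_nonneg x]
  have hx0 : x = 0 := by simpa [hy0] using e2
  have hy1 : y ^ 2 = 1 := by
    rw [hx0] at e1
    have : (Δ : ℚ) * (y ^ 2 - 1) = 0 := by linarith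
    rcases mul_eq_zero.mp this with h | h
    · exact absurd h hΔ'.ne'
    · linarith
  have hy : y = 1 := by
    -- the sign is fixed by the trace against `√-Δ`, which is constant on the subdomain
    rcases sq_eq_sq_iff_eq_or_eq_neg.mp (hy1.trans (one_pow 2).symm) with h | h
    · exact h
    · exfalso
      have h1 : b' * rho Δ ℝ * b = -rho Δ ℝ := by
        rw [← hMR, hxy, hx0, h, ← rho_map Δ (algebraMap ℚ ℝ)]
        ext i j
        simp
      have h2 := DomV_trace hΔ hβ
      rw [hact, Matrix.mul_assoc, Matrix.mul_assoc, Matrix.trace_mul_comm, Matrix.mul_assoc,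
        Matrix.mul_assoc, ← Matrix.mul_assoc b', h1, Matrix.mul_neg, Matrix.trace_neg,
        DomV_trace hΔ hzV] at h2
      exact hs (by linarith)
  have : M = rho Δ ℚ := by rw [hxy, hx0, hy]; simp
  have h := congrArg (fun L => toMat β * L) this
  simp only [hM, ← Matrix.mul_assoc, toMat_mul_inv, Matrix.one_mul] at h
  exact h.symm

/-! ### Stability of the lattice of a representative under `√-Δ` -/

theorem toMat_toGSp (p : ℕ) [Fact p.Prime] (σ : OpenRep) :
    toMat (σ.toGSp p) = (σ.mat p).map (Int.castRingHom ℚ) := rfl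

/-- The Gram matrix of the rows of `σ` for the symmetric form `(v, w) ↦ -v √-Δ J wᵀ`, the real
part of the Hermitian form of which `-J` is the imaginary part. -/
def gram (Δ p : ℕ) (σ : OpenRep) : Matrix Idx Idx ℤ :=
  σ.mat p * fromBlocks (hermE ℤ) 0 0 ((Δ : ℤ) • hermE ℤ) * (σ.mat p)ᵀ

theorem gram_eq (Δ p : ℕ) (σ : OpenRep) :
    gram Δ p σ = -(σ.mat p * rho Δ ℤ * symJ ℤ * (σ.mat p)ᵀ) := by
  rw [Matrix.mul_assoc (σ.mat p), rho_mul_symJ, gram]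
  simp

/-- The lattice spanned by the rows of `σ` is stable under `√-Δ`, in the form of a congruence. -/
def Stable (Δ p : ℕ) (σ : OpenRep) : Prop := ∀ i j, (p : ℤ) ^ 2 ∣ gram Δ p σ i j

theorem dvd_of_dvd_mul_symJ {n : ℤ} {G : Matrix Idx Idx ℤ} (h : ∀ i j, n ∣ (G * symJ ℤ) i j)
    (i j : Idx) : n ∣ G i j := by
  have h1 : G = -(G * symJ ℤ * symJ ℤ) := by
    rw [Matrix.mul_assoc, symJ_mul_symJ]; simp
  rw [h1, Matrix.neg_apply, Matrix.mul_apply, dvd_neg]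
  exact Finset.dvd_sum fun k _ => Dvd.dvd.mul_right (h i k) _

theorem map_toMat_toGSp_conj (p : ℕ) [Fact p.Prime] (Δ : ℕ) (σ : OpenRep) :
    ((p : ℚ) ^ 2) • (toMat (σ.toGSp p) * rho Δ ℚ * toMat (σ.toGSp p)⁻¹) =
      (gram Δ p σ * symJ ℤ).map (Int.castRingHom ℚ) := by
  have hp : ((p : ℚ) ^ 2) ≠ 0 := pow_ne_zero 2 (Nat.cast_ne_zero.mpr (Fact.out : p.Prime).ne_zero)
  have hinv : toMat (σ.toGSp p)⁻¹ =
      -((p : ℚ) ^ 2)⁻¹ • (symJ ℚ * (toMat (σ.toGSp p))ᵀ * symJ ℚ) :=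
    toMat_inv_eq (σ.toGSp p) (unitSq p) (sigmaMat_similitude p σ ℚ)
  rw [hinv, toMat_toGSp, gram_eq, ← rho_map Δ (Int.castRingHom ℚ), ← symJ_map (Int.castRingHom ℚ),
    ← transpose_map, Matrix.mul_smul, smul_smul, mul_neg, mul_inv_cancel₀ hp]
  simp only [← Matrix.map_mul]
  ext i j
  simp [Matrix.mul_assoc]

theorem Stable.exists_intMat {p : ℕ} [Fact p.Prime] {Δ : ℕ} {σ : OpenRep} (h : Stable Δ p σ) :
    ∃ R : Matrix Idx Idx ℤ, toMat (σ.toGSp p) * rho Δ ℚ * toMat (σ.toGSp p)⁻¹ =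
      R.map (Int.castRingHom ℚ) := by
  have hp : ((p : ℚ) ^ 2) ≠ 0 := pow_ne_zero 2 (Nat.cast_ne_zero.mpr (Fact.out : p.Prime).ne_zero)
  choose K hK using h
  have hK' : gram Δ p σ = (p : ℤ) ^ 2 • Matrix.of K := by
    ext i j; simp [hK]
  refine ⟨Matrix.of K * symJ ℤ, smul_right_injective _ hp ?_⟩
  simp only
  rw [map_toMat_toGSp_conj, hK', Matrix.smul_mul]
  ext i j
  simp only [Matrix.map_apply, Matrix.smul_apply, smul_eq_mul, map_mul, map_pow, map_natCast]

/-- Stability under `√-Δ` is the integrality of the conjugate of `√-Δ` by `σ`. -/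
theorem isIntegralMat_conj_iff (p : ℕ) [Fact p.Prime] (Δ : ℕ) (σ : OpenRep) :
    IsIntegralMat (toMat (diagA (σ.toGSp p)) * rho Δ Af * toMat (diagA (σ.toGSp p))⁻¹) ↔
      Stable Δ p σ := by
  have hmap : toMat (diagA (σ.toGSp p)) * rho Δ Af * toMat (diagA (σ.toGSp p))⁻¹ =
      (toMat (σ.toGSp p) * rho Δ ℚ * toMat (σ.toGSp p)⁻¹).map (algebraMap ℚ Af) := by
    rw [Matrix.map_mul, Matrix.map_mul, rho_map, ← map_inv]
    rfl
  rw [hmap]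
  constructor
  · intro h
    refine fun i j => dvd_of_dvd_mul_symJ (fun i j => ?_) i j
    obtain ⟨n, hn⟩ := exists_int_of_mem_integralAdeles _ (h i j)
    have h1 := congrFun (congrFun (map_toMat_toGSp_conj p Δ σ) i) j
    refine ⟨n, ?_⟩
    rw [Matrix.smul_apply, ← hn] at h1
    have h2 : ((gram Δ p σ * symJ ℤ) i j : ℚ) = (((p : ℤ) ^ 2 * n : ℤ) : ℚ) := by
      push_cast
      exact h1.symm
    exact_mod_cast h2
  · intro h
    obtain ⟨R, hR⟩ := h.exists_intMat
    rw [hR]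
    intro i j
    exact algebraMap_intCast_mem _

/-! ### The invariants of the module generated by a representative -/

section Invariants

variable (p : ℕ) [hp : Fact p.Prime]

instance neZero_sq : NeZero (p ^ 2) := ⟨pow_ne_zero 2 hp.out.ne_zero⟩

theorem natCast_mul_eq_zero_iff (x : ZMod (p ^ 2)) :
    (p : ZMod (p ^ 2)) * x = 0 ↔ ∃ y, y * (p : ZMod (p ^ 2)) = x := by
  constructor
  · intro h
    obtain ⟨n, rfl⟩ := ZMod.natCast_zmod_surjective x
    rw [← Nat.cast_mul, ZMod.natCast_eq_zero_iff, pow_two] at h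
    obtain ⟨m, rfl⟩ := Nat.dvd_of_mul_dvd_mul_left hp.out.pos h
    exact ⟨m, by push_cast; ring⟩
  · rintro ⟨y, rfl⟩
    have h : ((p : ZMod (p ^ 2)) * p) = 0 := by
      rw [← Nat.cast_mul, ← pow_two, ZMod.natCast_self]
    rw [mul_comm y, ← mul_assoc, h, zero_mul]

theorem natCast_sq_eq_zero (p : ℕ) : (p : ZMod (p ^ 2)) ^ 2 = 0 := by
  rw [← Nat.cast_pow, ZMod.natCast_self]

/-- The `p`-torsion of `ℤ/p²` has `p` elements. -/
theorem card_torsion : Nat.card {x : ZMod (p ^ 2) // (p : ZMod (p ^ 2)) * x = 0} = p := by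
  let f : ZMod (p ^ 2) →+ ZMod (p ^ 2) := AddMonoidHom.mulLeft (p : ZMod (p ^ 2))
  have h1 : f.range = f.ker := by
    ext x
    rw [AddMonoidHom.mem_ker, AddMonoidHom.mem_range]
    change _ ↔ (p : ZMod (p ^ 2)) * x = 0
    rw [natCast_mul_eq_zero_iff]
    exact exists_congr fun y => by rw [mul_comm]; rfl
  have h2 : Nat.card f.ker * Nat.card f.ker = p * p := by
    have := f.ker.card_eq_card_quotient_mul_card_addSubgroup
    rw [Nat.card_congr (QuotientAddGroup.quotientKerEquivRange f).toEquiv, h1,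
      Nat.card_zmod] at this
    rw [← this, pow_two]
  exact Nat.mul_self_inj.mp h2

/-- The diagonal entries of `τ`. -/
def tauDiag (p : ℕ) (R : Type*) [CommRing R] : Idx → R :=
  Sum.elim (Sum.elim (fun _ => (p : R)) fun _ => 1)
    (Sum.elim (fun _ => (p : R)) fun _ => (p : R) ^ 2)

theorem tauMat_eq_diagonal (p : ℕ) (R : Type*) [CommRing R] :
    tauMat p R = diagonal (tauDiag p R) := by
  ext ((i | i) | (i | i)) ((j | j) | (j | j)) <;> fin_cases i <;> fin_cases j <;>
    simp [tauMat, tauDiag]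

end Invariants

/-- The integral unipotent matrix `τ⁻¹ σ`. -/
def OpenRep.unip (σ : OpenRep) : Matrix Idx Idx ℤ :=
  fromBlocks (fromBlocks 1 0 (-σ.A) 1) (fromBlocks 0 σ.Cᵀ σ.C σ.U) 0 (fromBlocks 1 σ.Aᵀ 0 1)

theorem OpenRep.tauMat_mul_unip (p : ℕ) (σ : OpenRep) : tauMat p ℤ * σ.unip = σ.mat p := by
  simp only [tauMat, OpenRep.unip, OpenRep.mat, fromBlocks_multiply, Matrix.smul_mul,
    Matrix.one_mul, Matrix.zero_mul, Matrix.mul_zero, Matrix.mul_one, add_zero, zero_add]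

theorem OpenRep.unip_similitude (σ : OpenRep) : σ.unip * symJ ℤ * σ.unipᵀ = symJ ℤ := by
  have h := σ.mat_similitude 1
  have h1 : σ.mat 1 = σ.unip := by simp [OpenRep.unip, OpenRep.mat]
  rw [h1] at h
  simpa using h

section Invariants

variable (p : ℕ) [hp : Fact p.Prime] (σ : OpenRep)

theorem tauMat_map (p : ℕ) {R S : Type*} [CommRing R] [CommRing S] (f : R →+* S) :
    (tauMat p R).map f = tauMat p S := by
  rw [tauMat_eq_diagonal, tauMat_eq_diagonal, Matrix.diagonal_map (map_zero f)]
  congr 1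
  ext ((i | i) | (i | i)) <;> simp [tauDiag]

theorem mem_Wsub_iff (p : ℕ) (σ : OpenRep) (w : Idx → ZMod (p ^ 2)) :
    w ∈ Wsub p σ ↔ ∃ x, x ᵥ* sigmaMat p σ (ZMod (p ^ 2)) = w := by
  rw [Wsub, ← range_vecMulLinear]
  rfl

theorem sigmaMat_eq (p : ℕ) (σ : OpenRep) (R : Type*) [CommRing R] :
    sigmaMat p σ R = tauMat p R * σ.unip.map (Int.castRingHom R) := by
  rw [sigmaMat, ← OpenRep.tauMat_mul_unip, Matrix.map_mul, tauMat_map]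

theorem unip_vecMul_injective (R : Type*) [CommRing R] :
    Function.Injective fun y : Idx → R => y ᵥ* σ.unip.map (Int.castRingHom R) := by
  have h : σ.unip.map (Int.castRingHom R) *
      (-(symJ ℤ * σ.unipᵀ * symJ ℤ)).map (Int.castRingHom R) = 1 := by
    rw [← Matrix.map_mul, Matrix.mul_neg, ← Matrix.mul_assoc, ← Matrix.mul_assoc,
      OpenRep.unip_similitude, symJ_mul_symJ, neg_neg, Matrix.map_one _ (map_zero _) (map_one _)]
  intro y z hyz
  have := congrArg (· ᵥ* (-(symJ ℤ * σ.unipᵀ * symJ ℤ)).map (Int.castRingHom R)) hyz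
  simpa only [Matrix.vecMul_vecMul, h, Matrix.vecMul_one] using this

theorem Wsub_eq_image (p : ℕ) (σ : OpenRep) : (Wsub p σ : Set (Idx → ZMod (p ^ 2))) =
    (fun y => y ᵥ* σ.unip.map (Int.castRingHom (ZMod (p ^ 2)))) ''
      Set.univ.pi fun i => {y | ∃ x, x * tauDiag p (ZMod (p ^ 2)) i = y} := by
  ext w
  rw [SetLike.mem_coe, mem_Wsub_iff, sigmaMat_eq]
  simp only [← Matrix.vecMul_vecMul, tauMat_eq_diagonal]
  constructor
  · rintro ⟨x, rfl⟩
    exact ⟨_, fun i _ => ⟨x i, by rw [Matrix.vecMul_diagonal]⟩, rfl⟩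
  · rintro ⟨y, hy, rfl⟩
    choose x hx using fun i => hy i trivial
    refine ⟨x, ?_⟩
    simp only
    congr 1
    ext i
    rw [Matrix.vecMul_diagonal, hx]

theorem card_univ_pi {p : ℕ} (s : Idx → Set (ZMod (p ^ 2))) :
    Nat.card (Set.univ.pi s) = Nat.card (s (.inl (.inl 0))) * (Nat.card (s (.inl (.inr 0))) *
      Nat.card (s (.inl (.inr 1)))) * (Nat.card (s (.inr (.inl 0))) *
        (Nat.card (s (.inr (.inr 0))) * Nat.card (s (.inr (.inr 1))))) := by
  rw [Nat.card_congr (Equiv.Set.univPi s), Nat.card_pi]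
  simp [Fintype.prod_sum_type, Fin.prod_univ_two]

theorem card_Wsub : Nat.card (Wsub p σ) = p ^ 6 := by
  change Nat.card (Wsub p σ : Set (Idx → ZMod (p ^ 2))) = _
  rw [Wsub_eq_image, Nat.card_image_of_injective (unip_vecMul_injective σ _), card_univ_pi]
  have h1 : Nat.card ({y | ∃ x, x * (p : ZMod (p ^ 2)) = y} : Set (ZMod (p ^ 2))) = p := by
    refine (Nat.card_congr (Equiv.subtypeEquivRight fun x => ?_)).trans (card_torsion p)
    exact (natCast_mul_eq_zero_iff p x).symm
  have h2 : Nat.card ({y | ∃ x, x * 1 = y} : Set (ZMod (p ^ 2))) = p ^ 2 := by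
    simp
  have h3 : Nat.card ({y | ∃ x, x * (p : ZMod (p ^ 2)) ^ 2 = y} : Set (ZMod (p ^ 2))) = 1 := by
    simp [natCast_sq_eq_zero, eq_comm]
  simp only [tauDiag, Sum.elim_inl, Sum.elim_inr, h1, h2, h3]
  ring

theorem card_torsionBy_Wsub :
    Nat.card (Submodule.torsionBy (ZMod (p ^ 2)) (Wsub p σ) (p : ZMod (p ^ 2))) = p ^ 4 := by
  have h0 : (((Submodule.torsionBy (ZMod (p ^ 2)) (Wsub p σ) (p : ZMod (p ^ 2))).map
      (Wsub p σ).subtype : Submodule _ _) : Set (Idx → ZMod (p ^ 2))) =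
      (fun y => y ᵥ* σ.unip.map (Int.castRingHom (ZMod (p ^ 2)))) '' Set.univ.pi fun i =>
        {y | (∃ x, x * tauDiag p (ZMod (p ^ 2)) i = y) ∧ (p : ZMod (p ^ 2)) * y = 0} := by
    ext w
    have hw : w ∈ (Submodule.torsionBy (ZMod (p ^ 2)) (Wsub p σ) (p : ZMod (p ^ 2))).map
        (Wsub p σ).subtype ↔ w ∈ (Wsub p σ : Set _) ∧ (p : ZMod (p ^ 2)) • w = 0 := by
      constructor
      · rintro ⟨v, hv, rfl⟩
        exact ⟨v.2, congrArg Subtype.val ((Submodule.mem_torsionBy_iff _ _).mp hv)⟩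
      · rintro ⟨h1, h2⟩
        exact ⟨⟨w, h1⟩, (Submodule.mem_torsionBy_iff _ _).mpr (Subtype.ext h2), rfl⟩
    rw [SetLike.mem_coe, hw, Wsub_eq_image]
    constructor
    · rintro ⟨⟨y, hy, rfl⟩, h⟩
      refine ⟨y, fun i _ => ⟨hy i trivial, ?_⟩, rfl⟩
      have h' : (p : ZMod (p ^ 2)) • y = 0 := by
        refine unip_vecMul_injective σ _ ?_
        simp only
        rw [Matrix.smul_vecMul, Matrix.zero_vecMul]
        exact h
      exact congrFun h' i
    · rintro ⟨y, hy, rfl⟩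
      refine ⟨⟨y, fun i _ => (hy i trivial).1, rfl⟩, ?_⟩
      simp only
      rw [← Matrix.smul_vecMul]
      have : (p : ZMod (p ^ 2)) • y = 0 := funext fun i => (hy i trivial).2
      rw [this, Matrix.zero_vecMul]
  rw [Nat.card_congr (Submodule.equivMapOfInjective _ (Wsub p σ).injective_subtype _).toEquiv]
  change Nat.card (((Submodule.torsionBy (ZMod (p ^ 2)) (Wsub p σ) (p : ZMod (p ^ 2))).map
      (Wsub p σ).subtype : Submodule _ _) : Set (Idx → ZMod (p ^ 2))) = _
  rw [h0, Nat.card_image_of_injective (unip_vecMul_injective σ _), card_univ_pi]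
  have h1 : Nat.card ({y | (∃ x, x * (p : ZMod (p ^ 2)) = y) ∧ (p : ZMod (p ^ 2)) * y = 0} :
      Set (ZMod (p ^ 2))) = p := by
    refine (Nat.card_congr (Equiv.subtypeEquivRight fun x => ?_)).trans (card_torsion p)
    change (∃ y, y * (p : ZMod (p ^ 2)) = x) ∧ (p : ZMod (p ^ 2)) * x = 0 ↔ _
    rw [← natCast_mul_eq_zero_iff, and_self]
  have h2 : Nat.card ({y | (∃ x, x * 1 = y) ∧ (p : ZMod (p ^ 2)) * y = 0} :
      Set (ZMod (p ^ 2))) = p := by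
    refine (Nat.card_congr (Equiv.subtypeEquivRight fun x => ?_)).trans (card_torsion p)
    change (∃ y, y * 1 = x) ∧ (p : ZMod (p ^ 2)) * x = 0 ↔ _
    simp
  have h3 : Nat.card ({y | (∃ x, x * (p : ZMod (p ^ 2)) ^ 2 = y) ∧ (p : ZMod (p ^ 2)) * y = 0} :
      Set (ZMod (p ^ 2))) = 1 := by
    have : {y | (∃ x, x * (p : ZMod (p ^ 2)) ^ 2 = y) ∧ (p : ZMod (p ^ 2)) * y = 0} = {0} := by
      ext y
      simp only [natCast_sq_eq_zero, mul_zero, exists_const, Set.mem_ofPred_eq,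
        Set.mem_singleton_iff]
      constructor
      · exact fun h => h.1.symm
      · rintro rfl; simp
    rw [this]
    simp
  simp only [tauDiag, Sum.elim_inl, Sum.elim_inr, h1, h2, h3]
  ring

theorem hasInvariants_Wsub : HasInvariants p (Wsub p σ) 2 4 := by
  refine ⟨?_, card_torsionBy_Wsub p σ⟩
  have h := Submodule.card_eq_card_quotient_mul_card
    (Submodule.torsionBy (ZMod (p ^ 2)) (Wsub p σ) (p : ZMod (p ^ 2)))
  rw [card_Wsub, card_torsionBy_Wsub] at h
  have hpos : 0 < p ^ 4 := pow_pos hp.out.pos 4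
  refine Nat.eq_of_mul_eq_mul_left hpos ?_
  rw [← h]
  ring

theorem map_Wsub_le_iff (Δ : ℕ) :
    (Wsub p σ).map (vecMulLinear (alpha (R := ZMod (p ^ 2)) Δ 0 1)) ≤ Wsub p σ ↔
      Stable Δ p σ := by
  change (Wsub p σ).map (vecMulLinear (rho Δ (ZMod (p ^ 2)))) ≤ Wsub p σ ↔ _
  constructor
  · intro h
    have h1 : ∀ i, ∃ x, x ᵥ* sigmaMat p σ (ZMod (p ^ 2)) =
        (sigmaMat p σ (ZMod (p ^ 2))).row i ᵥ* rho Δ (ZMod (p ^ 2)) := fun i => by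
      rw [← mem_Wsub_iff]
      exact h ⟨_, Submodule.subset_span ⟨i, rfl⟩, rfl⟩
    choose X hX using h1
    have h2 : Matrix.of X * sigmaMat p σ (ZMod (p ^ 2)) =
        sigmaMat p σ (ZMod (p ^ 2)) * rho Δ (ZMod (p ^ 2)) := by
      ext i j
      exact congrFun (hX i) j
    have h3 : (gram Δ p σ).map (Int.castRingHom (ZMod (p ^ 2))) = 0 := by
      have h4 : (gram Δ p σ).map (Int.castRingHom (ZMod (p ^ 2))) =
          -(sigmaMat p σ (ZMod (p ^ 2)) * rho Δ (ZMod (p ^ 2)) * symJ (ZMod (p ^ 2)) *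
            (sigmaMat p σ (ZMod (p ^ 2)))ᵀ) := by
        rw [gram_eq, sigmaMat, ← rho_map Δ (Int.castRingHom (ZMod (p ^ 2))),
          ← symJ_map (Int.castRingHom (ZMod (p ^ 2))), ← transpose_map]
        simp only [← Matrix.map_mul]
        ext i j
        simp
      rw [h4, ← h2, Matrix.mul_assoc (Matrix.of X), Matrix.mul_assoc (Matrix.of X),
        sigmaMat_similitude, natCast_sq_eq_zero]
      simp
    intro i j
    have h5 := congrFun (congrFun h3 i) j
    simp only [Matrix.map_apply, Int.coe_castRingHom, Matrix.zero_apply,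
      ZMod.intCast_zmod_eq_zero_iff_dvd] at h5
    exact_mod_cast h5
  · intro h
    obtain ⟨R, hR⟩ := h.exists_intMat
    have h1 : σ.mat p * rho Δ ℤ = R * σ.mat p := by
      have h2 := congrArg (· * toMat (σ.toGSp p)) hR
      simp only [Matrix.mul_assoc, toMat_inv_mul, Matrix.mul_one] at h2
      rw [toMat_toGSp, ← rho_map Δ (Int.castRingHom ℚ), ← Matrix.map_mul, ← Matrix.map_mul] at h2
      exact Matrix.map_injective (RingHom.injective_int _) h2
    have h2 : sigmaMat p σ (ZMod (p ^ 2)) * rho Δ (ZMod (p ^ 2)) =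
        R.map (Int.castRingHom _) * sigmaMat p σ (ZMod (p ^ 2)) := by
      rw [sigmaMat, ← rho_map Δ (Int.castRingHom (ZMod (p ^ 2))), ← Matrix.map_mul,
        ← Matrix.map_mul, h1]
    rintro _ ⟨w, hw, rfl⟩
    obtain ⟨x, rfl⟩ := (mem_Wsub_iff p σ w).mp hw
    rw [mem_Wsub_iff]
    refine ⟨x ᵥ* R.map (Int.castRingHom _), ?_⟩
    rw [Matrix.vecMul_vecMul, ← h2, ← Matrix.vecMul_vecMul]
    rfl

/-- The module `O_K W_σ` has the invariants `(2, 4)` of `W_σ` exactly if it equals `W_σ`. -/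
theorem hasInvariants_OKspan_iff (Δ : ℕ) :
    HasInvariants p (OKspan p Δ (Wsub p σ)) 2 4 ↔ Stable Δ p σ := by
  rw [← map_Wsub_le_iff]
  constructor
  · rintro ⟨h1, h2⟩
    have h3 := Submodule.card_eq_card_quotient_mul_card
      (Submodule.torsionBy (ZMod (p ^ 2)) (OKspan p Δ (Wsub p σ)) (p : ZMod (p ^ 2)))
    rw [h1, h2] at h3
    have hle : Wsub p σ ≤ OKspan p Δ (Wsub p σ) := le_sup_left
    have h4 : (Wsub p σ : Set (Idx → ZMod (p ^ 2))) = OKspan p Δ (Wsub p σ) := by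
      refine Set.eq_of_subset_of_ncard_le hle ?_ (Set.toFinite _)
      change Nat.card (OKspan p Δ (Wsub p σ)) ≤ Nat.card (Wsub p σ)
      rw [h3, card_Wsub, ← pow_add]
    rw [SetLike.coe_set_eq] at h4
    conv_rhs => rw [h4]
    exact le_sup_right
  · intro h
    rw [OKspan, sup_eq_left.mpr h]
    exact hasInvariants_Wsub p σ

end Invariants

/-! ### Hermitian coordinates on rows -/

section Herm

variable (Δ : ℕ)

/-- The identification of rows `(a, b) ∈ ℤ⁶` with vectors `a + b E √-Δ` over `ℤ[√-Δ]`, under which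
`alpha Δ h k` acts as `h + k √-Δ`. -/
def herVec (v : Idx → ℤ) : Blk → ℤ√(-(Δ : ℤ)) :=
  Sum.elim (fun i => ⟨v (.inl (.inl i)), v (.inr (.inl i))⟩)
    fun i => ⟨v (.inl (.inr i)), -v (.inr (.inr i))⟩

variable {Δ}

/-- The Hermitian form with matrix `E`. -/
def herForm (s t : Blk → ℤ√(-(Δ : ℤ))) : ℤ√(-(Δ : ℤ)) :=
  s (.inl 0) * star (t (.inl 0)) - s (.inr 0) * star (t (.inr 0)) - s (.inr 1) * star (t (.inr 1))

theorem herForm_re (M M' : Matrix Idx Idx ℤ) (i j : Idx) :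
    (herForm (herVec Δ (M i)) (herVec Δ (M' j))).re =
      (M * fromBlocks (hermE ℤ) 0 0 ((Δ : ℤ) • hermE ℤ) * M'ᵀ) i j := by
  simp [herForm, herVec, Matrix.mul_apply, Fintype.sum_sum_type, hermE, Matrix.one_apply,
    -zsmul_eq_mul, -natCast_zsmul, -zsmul_one]
  ring

theorem herForm_im (M M' : Matrix Idx Idx ℤ) (i j : Idx) :
    (herForm (herVec Δ (M i)) (herVec Δ (M' j))).im = -(M * symJ ℤ * M'ᵀ) i j := by
  simp [herForm, herVec, Matrix.mul_apply, Fintype.sum_sum_type, symJ, Matrix.one_apply]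
  ring

theorem Stable.dvd_herForm {p : ℕ} {σ : OpenRep} (h : Stable Δ p σ) (i j : Idx) :
    (((p : ℤ) ^ 2 : ℤ) : ℤ√(-(Δ : ℤ))) ∣
      herForm (herVec Δ (σ.mat p i)) (herVec Δ (σ.mat p j)) := by
  rw [Zsqrtd.intCast_dvd, herForm_re, herForm_im, σ.mat_similitude]
  refine ⟨h i j, ?_⟩
  rw [Matrix.smul_apply, dvd_neg]
  exact dvd_mul_right _ _

/-- Cancellation of an integer prime to the modulus. -/
theorem dvd_of_dvd_intCast_mul {n b : ℤ} (hb : IsCoprime n b) {z : ℤ√(-(Δ : ℤ))}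
    (h : (n : ℤ√(-(Δ : ℤ))) ∣ b * z) : (n : ℤ√(-(Δ : ℤ))) ∣ z := by
  rw [Zsqrtd.intCast_dvd] at h ⊢
  simp only [Zsqrtd.re_mul, Zsqrtd.im_mul, Zsqrtd.re_intCast, Zsqrtd.im_intCast, mul_zero,
    zero_mul, add_zero] at h
  exact ⟨hb.dvd_of_dvd_mul_left h.1, hb.dvd_of_dvd_mul_left h.2⟩

/-- Cancellation of an element whose norm is prime to the modulus. -/
theorem dvd_of_dvd_mul_of_norm {n : ℤ} {b : ℤ√(-(Δ : ℤ))} (hb : IsCoprime n b.norm)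
    {z : ℤ√(-(Δ : ℤ))} (h : (n : ℤ√(-(Δ : ℤ))) ∣ b * z) : (n : ℤ√(-(Δ : ℤ))) ∣ z := by
  refine dvd_of_dvd_intCast_mul hb ?_
  rw [Zsqrtd.norm_eq_mul_conj, mul_comm b, mul_assoc]
  exact Dvd.dvd.mul_left h _

theorem intCast_dvd_star {n : ℤ} {z : ℤ√(-(Δ : ℤ))} (h : (n : ℤ√(-(Δ : ℤ))) ∣ z) :
    (n : ℤ√(-(Δ : ℤ))) ∣ star z := by
  rw [Zsqrtd.intCast_dvd] at h ⊢
  simpa using h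

/-- The vectors proportional to each other modulo `n` have minors divisible by `n`. -/
theorem dvd_minor {n b : ℤ} (hb : IsCoprime n b) (a : ℤ√(-(Δ : ℤ)))
    {x y x' y' : ℤ√(-(Δ : ℤ))} (h : (n : ℤ√(-(Δ : ℤ))) ∣ a * x + b * y)
    (h' : (n : ℤ√(-(Δ : ℤ))) ∣ a * x' + b * y') : (n : ℤ√(-(Δ : ℤ))) ∣ x * y' - x' * y := by
  refine dvd_of_dvd_intCast_mul hb ?_
  have h1 : (b : ℤ√(-(Δ : ℤ))) * (x * y' - x' * y) =
      x * (a * x' + b * y') - x' * (a * x + b * y) := by ring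
  rw [h1]
  exact dvd_sub (Dvd.dvd.mul_left h' _) (Dvd.dvd.mul_left h _)

end Herm

/-! ### Congruences satisfied by stable representatives -/

section Congruences

variable {p Δ : ℕ} {σ : OpenRep}

theorem gram_inl_inr (i : Fin 2) : gram Δ p σ (.inl (.inr i)) (.inl (.inl 0)) =
    -(p * (σ.A i 0 + Δ * (σ.U i 0 * σ.C 0 0 + σ.U i 1 * σ.C 1 0))) := by
  simp [gram, OpenRep.mat, Matrix.mul_apply, Fintype.sum_sum_type, hermE, Matrix.one_apply,
    -zsmul_eq_mul, -natCast_zsmul, -zsmul_one]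
  ring

theorem gram_inr_inl (i : Fin 2) : gram Δ p σ (.inl (.inr i)) (.inr (.inl 0)) =
    p * (Δ * (σ.C i 0 - (σ.U i 0 * σ.A 0 0 + σ.U i 1 * σ.A 1 0))) := by
  simp [gram, OpenRep.mat, Matrix.mul_apply, Fintype.sum_sum_type, hermE, Matrix.one_apply,
    -zsmul_eq_mul, -natCast_zsmul, -zsmul_one]
  ring

theorem gram_inr_inr (i j : Fin 2) : gram Δ p σ (.inl (.inr i)) (.inl (.inr j)) =
    σ.A i 0 * σ.A j 0 - (1 : Matrix (Fin 2) (Fin 2) ℤ) i j + Δ * (σ.C i 0 * σ.C j 0 -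
      (σ.U i 0 * σ.U j 0 + σ.U i 1 * σ.U j 1)) := by
  fin_cases i <;> fin_cases j <;>
  simp [gram, OpenRep.mat, Matrix.mul_apply, Fintype.sum_sum_type, hermE, Matrix.one_apply,
    -zsmul_eq_mul, -natCast_zsmul, -zsmul_one] <;>
  ring

theorem rel_apply (σ : OpenRep) :
    σ.C 0 0 * σ.A 1 0 - σ.A 0 0 * σ.C 1 0 = σ.U 0 1 - σ.U 1 0 := by
  have := congrFun (congrFun σ.rel 0) 1
  simpa [Matrix.mul_apply] using this

theorem not_dvd_of_legendreSym [Fact p.Prime] (hinert : legendreSym p (-(Δ : ℤ)) = -1) :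
    ¬ (p : ℤ) ∣ Δ := by
  intro h
  have : legendreSym p (-(Δ : ℤ)) = 0 := by
    rw [legendreSym.eq_zero_iff, ZMod.intCast_zmod_eq_zero_iff_dvd]
    exact (dvd_neg).mpr h
  rw [this] at hinert
  norm_num at hinert

/-- Inertness: the norm form of `ℤ[√-Δ]` is anisotropic modulo `p`. -/
theorem dvd_of_dvd_norm [Fact p.Prime] (hinert : legendreSym p (-(Δ : ℤ)) = -1) {a b : ℤ}
    (h : (p : ℤ) ∣ a ^ 2 + Δ * b ^ 2) : (p : ℤ) ∣ a ∧ (p : ℤ) ∣ b := by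
  refine legendreSym.prime_dvd_of_eq_neg_one hinert ?_
  rwa [neg_mul, sub_neg_eq_add]

theorem isCoprime_of_not_dvd [hp : Fact p.Prime] {a : ℤ} (h : ¬ (p : ℤ) ∣ a) :
    IsCoprime (p : ℤ) a :=
  ((Nat.prime_iff_prime_int.mp hp.out).coprime_iff_not_dvd).mpr h

theorem det_blk {R : Type*} [CommRing R] (M : Matrix Blk Blk R) :
    M.det = M (.inl 0) (.inl 0) * (M (.inr 0) (.inr 0) * M (.inr 1) (.inr 1) -
        M (.inr 0) (.inr 1) * M (.inr 1) (.inr 0)) -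
      M (.inl 0) (.inr 0) * (M (.inr 0) (.inl 0) * M (.inr 1) (.inr 1) -
        M (.inr 0) (.inr 1) * M (.inr 1) (.inl 0)) +
      M (.inl 0) (.inr 1) * (M (.inr 0) (.inl 0) * M (.inr 1) (.inr 0) -
        M (.inr 0) (.inr 0) * M (.inr 1) (.inl 0)) := by
  rw [← Matrix.det_submatrix_equiv_self (finSumFinEquiv (m := 1) (n := 2)).symm M]
  have e0 : (finSumFinEquiv (m := 1) (n := 2)).symm 0 = .inl 0 := rfl
  have e1 : (finSumFinEquiv (m := 1) (n := 2)).symm 1 = .inr 0 := rfl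
  have e2 : (finSumFinEquiv (m := 1) (n := 2)).symm 2 = .inr 1 := rfl
  rw [Matrix.det_fin_three]
  simp only [Matrix.submatrix_apply]
  erw [e0, e1, e2]
  ring

theorem Stable.dvd_A [hp : Fact p.Prime] (h : Stable Δ p σ) (i : Fin 2) :
    (p : ℤ) ∣ σ.A i 0 + Δ * (σ.U i 0 * σ.C 0 0 + σ.U i 1 * σ.C 1 0) := by
  have hp0 : (p : ℤ) ≠ 0 := by exact_mod_cast hp.out.ne_zero
  have h1 := h (.inl (.inr i)) (.inl (.inl 0))
  rw [gram_inl_inr, dvd_neg, pow_two] at h1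
  exact (mul_dvd_mul_iff_left hp0).mp h1

variable [hp : Fact p.Prime] (hinert : legendreSym p (-(Δ : ℤ)) = -1)
include hinert

theorem Stable.dvd_C (h : Stable Δ p σ) (i : Fin 2) :
    (p : ℤ) ∣ σ.C i 0 - (σ.U i 0 * σ.A 0 0 + σ.U i 1 * σ.A 1 0) := by
  have hp0 : (p : ℤ) ≠ 0 := by exact_mod_cast hp.out.ne_zero
  have h1 := h (.inl (.inr i)) (.inr (.inl 0))
  rw [gram_inr_inl, pow_two] at h1
  have h2 := (mul_dvd_mul_iff_left hp0).mp h1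
  exact ((Nat.prime_iff_prime_int.mp hp.out).dvd_or_dvd h2).resolve_left
    (not_dvd_of_legendreSym hinert)

/-- Modulo `p`, a stable representative has `Δ U² = -1`; this is the first row of that equation. -/
theorem Stable.dvd_U (h : Stable Δ p σ) :
    (p : ℤ) ∣ Δ * (σ.U 0 0 ^ 2 + σ.U 0 1 * σ.U 1 0) + 1 ∧
      (p : ℤ) ∣ Δ * (σ.U 0 1 * (σ.U 0 0 + σ.U 1 1)) := by
  obtain ⟨a0, ha0⟩ := h.dvd_A 0
  obtain ⟨c0, hc0⟩ := h.dvd_C hinert 0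
  obtain ⟨k, hk⟩ := h (.inl (.inr 0)) (.inl (.inr 0))
  obtain ⟨l, hl⟩ := h (.inl (.inr 0)) (.inl (.inr 1))
  rw [gram_inr_inr] at hk hl
  simp at hk hl
  have hr := rel_apply σ
  constructor
  · refine ⟨-(p * k) + σ.A 0 0 * a0 + Δ * σ.C 0 0 * c0, ?_⟩
    linear_combination -hk + σ.A 0 0 * ha0 + Δ * σ.C 0 0 * hc0 + Δ * σ.U 0 1 * hr
  · refine ⟨-(p * l) + σ.A 1 0 * a0 + Δ * σ.C 1 0 * c0, ?_⟩
    linear_combination -hl + σ.A 1 0 * ha0 + Δ * σ.C 1 0 * hc0 - Δ * σ.U 0 0 * hr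

theorem Stable.not_dvd_U (h : Stable Δ p σ) : ¬ (p : ℤ) ∣ σ.U 0 1 := by
  intro h0
  obtain ⟨k, hk⟩ := (h.dvd_U hinert).1
  obtain ⟨l, hl⟩ := h0
  have h1 : (p : ℤ) ∣ (Δ * σ.U 0 0) ^ 2 + Δ * 1 ^ 2 :=
    ⟨Δ * k - Δ ^ 2 * l * σ.U 1 0, by linear_combination Δ * hk - Δ ^ 2 * σ.U 1 0 * hl⟩
  have h2 := (dvd_of_dvd_norm hinert h1).2
  exact (Nat.prime_iff_prime_int.mp hp.out).not_dvd_one h2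

/-- Modulo `p`, the second block row of a stable representative spans a line over `𝔽_{p²}`. -/
theorem Stable.dvd_minor (h : Stable Δ p σ) (i j : Blk) :
    ((p : ℤ) : ℤ√(-(Δ : ℤ))) ∣
      herVec Δ (σ.mat p (.inl (.inr 0))) i * herVec Δ (σ.mat p (.inl (.inr 1))) j -
        herVec Δ (σ.mat p (.inl (.inr 0))) j * herVec Δ (σ.mat p (.inl (.inr 1))) i := by
  have hp' := Nat.prime_iff_prime_int.mp hp.out
  have hb : IsCoprime (p : ℤ) (Δ * σ.U 0 1) := by
    refine isCoprime_of_not_dvd fun h0 => ?_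
    rcases hp'.dvd_or_dvd h0 with h1 | h1
    · exact not_dvd_of_legendreSym hinert h1
    · exact h.not_dvd_U hinert h1
  have key : ∀ i : Blk, ((p : ℤ) : ℤ√(-(Δ : ℤ))) ∣
      (⟨Δ * σ.U 0 0, -1⟩ : ℤ√(-(Δ : ℤ))) * herVec Δ (σ.mat p (.inl (.inr 0))) i +
        ((Δ * σ.U 0 1 : ℤ) : ℤ√(-(Δ : ℤ))) * herVec Δ (σ.mat p (.inl (.inr 1))) i := by
    intro i
    obtain ⟨a0, ha0⟩ := h.dvd_A 0
    obtain ⟨c0, hc0⟩ := h.dvd_C hinert 0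
    obtain ⟨⟨k, hk⟩, l, hl⟩ := h.dvd_U hinert
    rw [Zsqrtd.intCast_dvd]
    rcases i with i | i <;> fin_cases i <;>
      simp [herVec, OpenRep.mat, -dvd_mul_right, -dvd_mul_left]
    · exact ⟨⟨Δ * c0, by linear_combination Δ * hc0⟩, ⟨a0, by linear_combination ha0⟩⟩
    · exact ⟨-k, by linear_combination -hk⟩
    · exact ⟨-l, by linear_combination -hl⟩
  exact Picard.dvd_minor hb _ (key i) (key j)

/-- The row `x` of a stable representative that generates its reduction is off the isotropic line
of `(1, 1, 0)`, so that its second light-cone coordinate `x₁ - x₂` is a unit modulo `p`. -/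
theorem Stable.isCoprime_norm (h : Stable Δ p σ) :
    IsCoprime (p : ℤ) (herVec Δ (σ.mat p (.inl (.inr 0))) (.inl 0) -
      herVec Δ (σ.mat p (.inl (.inr 0))) (.inr 0)).norm := by
  refine isCoprime_of_not_dvd fun h0 => ?_
  have hp' := Nat.prime_iff_prime_int.mp hp.out
  obtain ⟨k, hk⟩ := h (.inl (.inr 0)) (.inl (.inr 0))
  rw [gram_inr_inr] at hk
  simp at hk
  simp [herVec, OpenRep.mat, Zsqrtd.norm_def] at h0
  have h1 := dvd_of_dvd_norm hinert (a := -σ.A 0 0 - 1) (b := σ.C 0 0 + σ.U 0 0) (by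
    convert h0 using 1; ring)
  obtain ⟨⟨a, ha⟩, b, hb⟩ := h1
  have h2 : (p : ℤ) ∣ Δ * σ.U 0 1 ^ 2 := by
    refine ⟨-(p * k) + a * (1 - σ.A 0 0) + Δ * b * (σ.C 0 0 - σ.U 0 0), ?_⟩
    linear_combination -hk + (1 - σ.A 0 0) * ha + Δ * (σ.C 0 0 - σ.U 0 0) * hb
  rcases hp'.dvd_or_dvd h2 with h3 | h3
  · exact not_dvd_of_legendreSym hinert h3
  · exact h.not_dvd_U hinert (hp'.dvd_of_dvd_pow h3)

/-- Stable representatives lie in `𝔇_*`: the last two rows of `μ₁` and `μ₂` are proportional. -/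
theorem Stable.dvd_det (h : Stable Δ p σ) (M : Matrix Blk Blk (ℤ√(-(Δ : ℤ))))
    (h0 : ∀ i, M (.inr 0) i = -star (herVec Δ (σ.mat p (.inl (.inr 0))) i))
    (h1 : ∀ i, M (.inr 1) i = -star (herVec Δ (σ.mat p (.inl (.inr 1))) i)) :
    (p : ℤ√(-(Δ : ℤ))) ∣ M.det := by
  have key : ∀ i j, (p : ℤ√(-(Δ : ℤ))) ∣
      M (.inr 0) i * M (.inr 1) j - M (.inr 0) j * M (.inr 1) i := fun i j => by
    have := intCast_dvd_star (h.dvd_minor hinert i j)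
    rw [h0, h1, h0, h1, neg_mul_neg, neg_mul_neg, ← star_mul', ← star_mul', ← star_sub]
    exact_mod_cast this
  rw [det_blk]
  exact dvd_add (dvd_sub (Dvd.dvd.mul_left (key _ _) _) (Dvd.dvd.mul_left (key _ _) _))
    (Dvd.dvd.mul_left (key _ _) _)

theorem Stable.mem_DStar (h : Stable Δ p σ) {R₁ R₂ : Set ℤ} (hσ : σ ∈ SOpen R₁ R₂) :
    σ ∈ DStar p Δ R₁ R₂ := by
  refine ⟨hσ, h.dvd_det hinert _ ?_ ?_, h.dvd_det hinert _ ?_ ?_⟩ <;>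
  · rintro (i | i) <;> fin_cases i <;>
      simp [mu1, mu2, herVec, OpenRep.mat, sqrtNeg, Zsqrtd.ext_iff]

/-- The set `𝔇_{0,*}` consists of the stable representatives. -/
theorem mem_DZeroStar_iff {R₁ R₂ : Set ℤ} (hσ : σ ∈ SOpen R₁ R₂) :
    σ ∈ DZeroStar p Δ R₁ R₂ ↔ Stable Δ p σ := by
  constructor
  · exact fun h => (hasInvariants_OKspan_iff p σ Δ).mp h.2
  · exact fun h => ⟨h.mem_DStar hinert hσ, (hasInvariants_OKspan_iff p σ Δ).mpr h⟩

end Congruences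

/-! ### Moving isotropic vectors by integral unipotents -/

section Unipotent

variable {Δ : ℕ}

/-- An isotropic vector modulo `p²` off the line of `(1, 1, 0)` is proportional to the image of
`(1, -1, 0)` under an integral unipotent of prescribed level fixing `(1, 1, 0)`. The unipotent has
the parameters `d = d₁ + d₂ √-Δ` and `m = n + y √-Δ`, where `2 n` is the norm of `d`. -/
theorem exists_unipotent_parameters {p N : ℕ} (hN : IsCoprime ((p : ℤ) ^ 2) (2 * N))
    (x : Blk → ℤ√(-(Δ : ℤ))) (hx : (((p : ℤ) ^ 2 : ℤ) : ℤ√(-(Δ : ℤ))) ∣ herForm x x)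
    (hD : IsCoprime (p : ℤ) (x (.inl 0) - x (.inr 0)).norm) :
    ∃ n y d₁ d₂ : ℤ, 2 * n = d₁ ^ 2 + Δ * d₂ ^ 2 ∧ (N : ℤ) ∣ y ∧ (N : ℤ) ∣ d₂ ∧
      (((p : ℤ) ^ 2 : ℤ) : ℤ√(-(Δ : ℤ))) ∣
        (x (.inl 0) - x (.inr 0)) * (1 + 2 * ⟨n, y⟩) - 2 * x (.inl 0) ∧
      (((p : ℤ) ^ 2 : ℤ) : ℤ√(-(Δ : ℤ))) ∣
        (x (.inl 0) - x (.inr 0)) * (2 * ⟨n, y⟩ - 1) - 2 * x (.inr 0) ∧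
      (((p : ℤ) ^ 2 : ℤ) : ℤ√(-(Δ : ℤ))) ∣
        (x (.inl 0) - x (.inr 0)) * ⟨d₁, d₂⟩ - x (.inr 1) := by
  set D := x (.inl 0) - x (.inr 0) with hDdef
  obtain ⟨u, v, huv⟩ := hN.mul_right hD.pow_left
  obtain ⟨k, hk⟩ := ((Zsqrtd.intCast_dvd _ _).mp hx).1
  have hDD := D.norm_eq_mul_conj
  have huv' : (2 * N * v : ℤ√(-(Δ : ℤ))) * (D * star D) =
      1 - (((p : ℤ) ^ 2 : ℤ) : ℤ√(-(Δ : ℤ))) * u := by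
    rw [← hDD]
    have h := congrArg (Int.cast : ℤ → ℤ√(-(Δ : ℤ))) huv
    push_cast at h ⊢
    linear_combination h
  let d : ℤ√(-(Δ : ℤ)) := (2 * N * v : ℤ) * (x (.inr 1) * star D)
  let n : ℤ := 2 * N ^ 2 * v ^ 2 * (x (.inr 1)).norm * D.norm
  let y : ℤ := N * v * ((x (.inl 0) + x (.inr 0)) * star D).im
  have hn : 2 * n = d.re ^ 2 + Δ * d.im ^ 2 := by
    have h1 : d.norm = d.re ^ 2 + Δ * d.im ^ 2 := by rw [Zsqrtd.norm_def]; ring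
    have h2 : d.norm = (2 * N * v) ^ 2 * ((x (.inr 1)).norm * D.norm) := by
      simp only [d, Zsqrtd.norm_mul, Zsqrtd.norm_intCast, Zsqrtd.norm_conj]
      ring
    rw [← h1, h2]
    ring
  have hm : ∃ κ : ℤ, (⟨n, y⟩ : ℤ√(-(Δ : ℤ))) =
      (N * v : ℤ) * ((x (.inl 0) + x (.inr 0)) * star D) +
        (((p : ℤ) ^ 2 : ℤ) : ℤ√(-(Δ : ℤ))) * κ := by
    refine ⟨-(N * v * (x (.inr 1)).norm * u) - N * v * k, ?_⟩
    rw [← Int.cast_mul, Zsqrtd.ext_iff]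
    constructor
    · simp only [Zsqrtd.re_add, Zsqrtd.re_intCast, n]
      have h3 : ((x (.inl 0) + x (.inr 0)) * star D).re = (x (.inr 1)).norm + (p : ℤ) ^ 2 * k := by
        rw [← hk, hDdef]
        simp [herForm, Zsqrtd.norm_def]
        ring
      rw [Zsqrtd.re_mul, h3]
      simp
      linear_combination (N * v * (x (.inr 1)).norm) * huv
    · simp only [Zsqrtd.im_add, Zsqrtd.im_mul, Zsqrtd.im_intCast, Zsqrtd.re_intCast, y]
      ring
  obtain ⟨κ, hκ⟩ := hm
  refine ⟨n, y, d.re, d.im, hn,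
    ⟨v * ((x (.inl 0) + x (.inr 0)) * star D).im, by simp only [y]; ring⟩,
    ⟨2 * v * (x (.inr 1) * star D).im, ?_⟩, ?_, ?_, ?_⟩
  · simp only [d, Zsqrtd.im_mul, Zsqrtd.re_intCast, Zsqrtd.im_intCast]
    ring
  · refine ⟨-u * (x (.inl 0) + x (.inr 0)) + 2 * κ * D, ?_⟩
    rw [hκ]
    push_cast at huv' ⊢
    linear_combination (x (.inl 0) + x (.inr 0)) * huv' + hDdef
  · refine ⟨-u * (x (.inl 0) + x (.inr 0)) + 2 * κ * D, ?_⟩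
    rw [hκ]
    push_cast at huv' ⊢
    linear_combination (x (.inl 0) + x (.inr 0)) * huv' - hDdef
  · refine ⟨-u * x (.inr 1), ?_⟩
    have : (⟨d.re, d.im⟩ : ℤ√(-(Δ : ℤ))) = d := rfl
    rw [this]
    simp only [d]
    push_cast at huv' ⊢
    linear_combination x (.inr 1) * huv'

/-- The coordinates `h` of the unipotent `h + k √-Δ` in `SU(1,2)` that fixes `(1, 1, 0)` and sends
`(1, -1, 0)` to `(1 + 2 m, 2 m - 1, 2 d)`. -/
def unipH (n d₁ : ℤ) : Matrix Blk Blk ℤ :=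
  fromBlocks !![1 + n] !![n, d₁] !![-n; d₁] !![1 - n, -d₁; d₁, 1]

/-- The coordinates `k` of the unipotent `h + k √-Δ`. -/
def unipK (y d₂ : ℤ) : Matrix Blk Blk ℤ :=
  fromBlocks !![y] !![y, d₂] !![-y; -d₂] !![-y, -d₂; -d₂, 0]

theorem unip_unitary {n y d₁ d₂ : ℤ} (hn : 2 * n = d₁ ^ 2 + Δ * d₂ ^ 2) :
    unipH n d₁ * hermE ℤ * (unipH n d₁)ᵀ +
      (Δ : ℤ) • (unipK y d₂ * hermE ℤ * (unipK y d₂)ᵀ) = hermE ℤ := by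
  ext (i | i) (j | j) <;> fin_cases i <;> fin_cases j <;>
    simp [Matrix.mul_apply, Fintype.sum_sum_type, unipH, unipK, hermE, Matrix.one_apply,
      -zsmul_eq_mul, -natCast_zsmul] <;> linarith

theorem unip_unitary' (n y d₁ d₂ : ℤ) :
    unipK y d₂ * hermE ℤ * (unipH n d₁)ᵀ = unipH n d₁ * hermE ℤ * (unipK y d₂)ᵀ := by
  ext (i | i) (j | j) <;> fin_cases i <;> fin_cases j <;>
    simp [Matrix.mul_apply, Fintype.sum_sum_type, unipH, unipK, hermE, Matrix.one_apply] <;> ring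

/-- The real element `diag(p², p, 1)` of `GU(1,2)` in the isotropic basis `(1, 1, 0)`, `(0, 0, 1)`,
`(1, -1, 0)`, where `p² = 2 e + 1`. -/
def heckeH (p e : ℤ) : Matrix Blk Blk ℤ :=
  fromBlocks !![e + 1] !![e, 0] !![e; 0] !![e + 1, 0; 0, p]

theorem heckeH_unitary {p e : ℤ} (he : p ^ 2 = 2 * e + 1) :
    heckeH p e * hermE ℤ * (heckeH p e)ᵀ = (p ^ 2) • hermE ℤ := by
  ext (i | i) (j | j) <;> fin_cases i <;> fin_cases j <;>
    simp [Matrix.mul_apply, Fintype.sum_sum_type, heckeH, hermE, Matrix.one_apply,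
      -zsmul_eq_mul, he] <;> linarith

theorem alpha_zero_mul_alpha (h h' k' : Matrix Blk Blk ℤ) :
    alpha Δ h 0 * alpha Δ h' k' = alpha Δ (h * h') (h * k') := by
  simp [alpha, fromBlocks_multiply, Matrix.mul_assoc, hermE_mul_cancel, -zsmul_eq_mul,
    -natCast_zsmul]

/-- The rows of `alpha Δ h k` span the `ℤ[√-Δ]`-module generated by the rows of `h + k √-Δ`. -/
theorem dvd_symplectic_of_dvd_herForm {n : ℤ} (M : Matrix Idx Idx ℤ) (h k : Matrix Blk Blk ℤ)
    (r : Idx) (H : ∀ i, (n : ℤ√(-(Δ : ℤ))) ∣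
      herForm (herVec Δ (M r)) fun j => ⟨h i j, k i j⟩) (i : Idx) :
    n ∣ (M * symJ ℤ * (alpha Δ h k)ᵀ) r i := by
  have h0 := herForm_im (Δ := Δ) M (alpha Δ h k) r i
  rw [← dvd_neg, ← h0]
  suffices (n : ℤ√(-(Δ : ℤ))) ∣ herForm (herVec Δ (M r)) (herVec Δ (alpha Δ h k i)) from
    ((Zsqrtd.intCast_dvd _ _).mp this).2
  rcases i with i | i
  · have h1 : herVec Δ (alpha Δ h k (.inl i)) = fun j => ⟨h i j, k i j⟩ := by
      funext j
      rcases j with j | j <;> fin_cases j <;>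
        simp [herVec, alpha, Matrix.mul_apply, Fintype.sum_sum_type, hermE, Matrix.one_apply]
    rw [h1]
    exact H i
  · have h1 : herVec Δ (alpha Δ h k (.inr i)) =
        fun j => ⟨0, hermE ℤ i i⟩ * ⟨h i j, k i j⟩ := by
      funext j
      rcases i with i | i <;> rcases j with j | j <;> fin_cases i <;> fin_cases j <;>
        simp [herVec, alpha, Matrix.mul_apply, Fintype.sum_sum_type, hermE, Matrix.one_apply,
          Zsqrtd.ext_iff, -zsmul_eq_mul, -natCast_zsmul]
    have h2 : herForm (herVec Δ (M r)) (fun j => ⟨0, hermE ℤ i i⟩ * ⟨h i j, k i j⟩) =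
        star (⟨0, hermE ℤ i i⟩ : ℤ√(-(Δ : ℤ))) *
          herForm (herVec Δ (M r)) fun j => ⟨h i j, k i j⟩ := by
      simp only [herForm, star_mul']
      ring
    rw [h1, h2]
    exact Dvd.dvd.mul_left (H i) _

/-- The rows of the product of `heckeH` with the unipotent are orthogonal modulo `p²` to all
vectors that are orthogonal modulo `p²`, and proportional modulo `p`, to the given vector `x`. -/
theorem dvd_herForm_hecke_unip {p : ℕ} {e n y d₁ d₂ : ℤ}
    (he : (p : ℤ) ^ 2 = 2 * e + 1) (x s : Blk → ℤ√(-(Δ : ℤ)))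
    (hD : IsCoprime (p : ℤ) (x (.inl 0) - x (.inr 0)).norm)
    (h0 : (((p : ℤ) ^ 2 : ℤ) : ℤ√(-(Δ : ℤ))) ∣
      (x (.inl 0) - x (.inr 0)) * (1 + 2 * ⟨n, y⟩) - 2 * x (.inl 0))
    (h1 : (((p : ℤ) ^ 2 : ℤ) : ℤ√(-(Δ : ℤ))) ∣
      (x (.inl 0) - x (.inr 0)) * (2 * ⟨n, y⟩ - 1) - 2 * x (.inr 0))
    (h2 : (((p : ℤ) ^ 2 : ℤ) : ℤ√(-(Δ : ℤ))) ∣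
      (x (.inl 0) - x (.inr 0)) * ⟨d₁, d₂⟩ - x (.inr 1))
    (hs : (((p : ℤ) ^ 2 : ℤ) : ℤ√(-(Δ : ℤ))) ∣ herForm s x)
    (hmin : ∀ i j, ((p : ℤ) : ℤ√(-(Δ : ℤ))) ∣ s i * x j - s j * x i) (i : Blk) :
    (((p : ℤ) ^ 2 : ℤ) : ℤ√(-(Δ : ℤ))) ∣ herForm s fun j =>
      ⟨(heckeH p e * unipH n d₁) i j, (heckeH p e * unipK y d₂) i j⟩ := by
  set D := x (.inl 0) - x (.inr 0) with hDdef
  set m : ℤ√(-(Δ : ℤ)) := ⟨n, y⟩ with hm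
  set d : ℤ√(-(Δ : ℤ)) := ⟨d₁, d₂⟩ with hd
  -- the image of `(1, -1, 0)` is proportional to `x`
  have hw : (((p : ℤ) ^ 2 : ℤ) : ℤ√(-(Δ : ℤ))) ∣
      s (.inl 0) * star (1 + 2 * m) - s (.inr 0) * star (2 * m - 1) -
        s (.inr 1) * star (2 * d) := by
    have hD' : IsCoprime ((p : ℤ) ^ 2) (star D).norm := by
      rw [Zsqrtd.norm_conj]; exact hD.pow_left
    refine dvd_of_dvd_mul_of_norm hD' ?_
    have h : star D * (s (.inl 0) * star (1 + 2 * m) - s (.inr 0) * star (2 * m - 1) -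
        s (.inr 1) * star (2 * d)) = s (.inl 0) * star (D * (1 + 2 * m) - 2 * x (.inl 0)) -
          s (.inr 0) * star (D * (2 * m - 1) - 2 * x (.inr 0)) -
          s (.inr 1) * star (D * d - x (.inr 1)) * 2 + 2 * herForm s x := by
      simp only [herForm, star_mul', star_sub, star_add, star_one, star_ofNat]
      ring
    rw [h]
    exact dvd_add (dvd_sub (dvd_sub (Dvd.dvd.mul_left (intCast_dvd_star h0) _)
      (Dvd.dvd.mul_left (intCast_dvd_star h1) _))
      (Dvd.dvd.mul_right (Dvd.dvd.mul_left (intCast_dvd_star h2) _) _)) (Dvd.dvd.mul_left hs _)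
  have h3 : ((p : ℤ) : ℤ√(-(Δ : ℤ))) ∣ s (.inl 0) * d - s (.inr 0) * d - s (.inr 1) := by
    refine dvd_of_dvd_mul_of_norm hD ?_
    have h : D * (s (.inl 0) * d - s (.inr 0) * d - s (.inr 1)) =
        (s (.inl 0) - s (.inr 0)) * (D * d - x (.inr 1)) +
          (s (.inl 0) * x (.inr 1) - s (.inr 1) * x (.inl 0)) -
          (s (.inr 0) * x (.inr 1) - s (.inr 1) * x (.inr 0)) := by
      rw [hDdef]; ring
    have h2' : ((p : ℤ) : ℤ√(-(Δ : ℤ))) ∣ D * d - x (.inr 1) :=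
      dvd_trans ⟨((p : ℤ) : ℤ√(-(Δ : ℤ))), by push_cast; ring⟩ h2
    rw [h]
    exact dvd_sub (dvd_add (Dvd.dvd.mul_left h2' _) (hmin _ _)) (hmin _ _)
  have hodd : IsCoprime ((p : ℤ) ^ 2) 2 := ⟨1, -e, by rw [he]; ring⟩
  have he' : (((p : ℤ) ^ 2 : ℤ) : ℤ√(-(Δ : ℤ))) = 2 * e + 1 := by
    rw [he]; push_cast; ring
  have hg : ∀ i j, (⟨(heckeH p e * unipH n d₁) i j, (heckeH p e * unipK y d₂) i j⟩ :
      ℤ√(-(Δ : ℤ))) = heckeH p e i (.inl 0) * ⟨unipH n d₁ (.inl 0) j, unipK y d₂ (.inl 0) j⟩ +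
        heckeH p e i (.inr 0) * ⟨unipH n d₁ (.inr 0) j, unipK y d₂ (.inr 0) j⟩ +
        heckeH p e i (.inr 1) * ⟨unipH n d₁ (.inr 1) j, unipK y d₂ (.inr 1) j⟩ := by
    intro i j
    rw [Zsqrtd.ext_iff]
    simp [Matrix.mul_apply, Fintype.sum_sum_type, add_assoc]
  have e00 : (⟨unipH n d₁ (.inl 0) (.inl 0), unipK y d₂ (.inl 0) (.inl 0)⟩ :
      ℤ√(-(Δ : ℤ))) = 1 + m := by simp [unipH, unipK, Zsqrtd.ext_iff, hm]
  have e01 : (⟨unipH n d₁ (.inl 0) (.inr 0), unipK y d₂ (.inl 0) (.inr 0)⟩ :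
      ℤ√(-(Δ : ℤ))) = m := by simp [unipH, unipK, hm]
  have e02 : (⟨unipH n d₁ (.inl 0) (.inr 1), unipK y d₂ (.inl 0) (.inr 1)⟩ :
      ℤ√(-(Δ : ℤ))) = d := by simp [unipH, unipK, hd]
  have e10 : (⟨unipH n d₁ (.inr 0) (.inl 0), unipK y d₂ (.inr 0) (.inl 0)⟩ :
      ℤ√(-(Δ : ℤ))) = -m := by simp [unipH, unipK, Zsqrtd.ext_iff, hm]
  have e11 : (⟨unipH n d₁ (.inr 0) (.inr 0), unipK y d₂ (.inr 0) (.inr 0)⟩ :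
      ℤ√(-(Δ : ℤ))) = 1 - m := by simp [unipH, unipK, Zsqrtd.ext_iff, hm]
  have e12 : (⟨unipH n d₁ (.inr 0) (.inr 1), unipK y d₂ (.inr 0) (.inr 1)⟩ :
      ℤ√(-(Δ : ℤ))) = -d := by simp [unipH, unipK, Zsqrtd.ext_iff, hd]
  have e20 : (⟨unipH n d₁ (.inr 1) (.inl 0), unipK y d₂ (.inr 1) (.inl 0)⟩ :
      ℤ√(-(Δ : ℤ))) = star d := by simp [unipH, unipK, hd]
  have e21 : (⟨unipH n d₁ (.inr 1) (.inr 0), unipK y d₂ (.inr 1) (.inr 0)⟩ :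
      ℤ√(-(Δ : ℤ))) = star d := by simp [unipH, unipK, hd]
  have e22 : (⟨unipH n d₁ (.inr 1) (.inr 1), unipK y d₂ (.inr 1) (.inr 1)⟩ :
      ℤ√(-(Δ : ℤ))) = 1 := by simp [unipH, unipK, Zsqrtd.ext_iff]
  simp only [hg, herForm, e00, e01, e02, e10, e11, e12, e20, e21, e22]
  rcases i with i | i <;> fin_cases i
  · refine dvd_of_dvd_intCast_mul hodd ?_
    have h : ∀ T : ℤ√(-(Δ : ℤ)), 2 * T = (((p : ℤ) ^ 2 : ℤ) : ℤ√(-(Δ : ℤ))) *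
        (s (.inl 0) - s (.inr 0)) + (s (.inl 0) * star (1 + 2 * m) -
          s (.inr 0) * star (2 * m - 1) - s (.inr 1) * star (2 * d)) →
        (((p : ℤ) ^ 2 : ℤ) : ℤ√(-(Δ : ℤ))) ∣ ((2 : ℤ) : ℤ√(-(Δ : ℤ))) * T := by
      intro T hT
      rw [Int.cast_ofNat, hT]
      exact dvd_add (dvd_mul_right _ _) hw
    refine h _ ?_
    rw [he']
    simp [heckeH]
    ring
  · refine dvd_of_dvd_intCast_mul hodd ?_
    have h : ∀ T : ℤ√(-(Δ : ℤ)), 2 * T = (((p : ℤ) ^ 2 : ℤ) : ℤ√(-(Δ : ℤ))) *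
        (s (.inl 0) - s (.inr 0)) - (s (.inl 0) * star (1 + 2 * m) -
          s (.inr 0) * star (2 * m - 1) - s (.inr 1) * star (2 * d)) →
        (((p : ℤ) ^ 2 : ℤ) : ℤ√(-(Δ : ℤ))) ∣ ((2 : ℤ) : ℤ√(-(Δ : ℤ))) * T := by
      intro T hT
      rw [Int.cast_ofNat, hT]
      exact dvd_sub (dvd_mul_right _ _) hw
    refine h _ ?_
    rw [he']
    simp [heckeH]
    ring
  · obtain ⟨c, hc⟩ := h3
    refine ⟨c, ?_⟩
    push_cast at hc ⊢
    simp [heckeH]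
    linear_combination (p : ℤ√(-(Δ : ℤ))) * hc

end Unipotent

/-! ### Factorization of stable representatives -/

section Factorization

theorem map_similitude {M : Matrix Idx Idx ℤ} {c : ℤ} (h : M * symJ ℤ * Mᵀ = c • symJ ℤ) :
    M.map (Int.castRingHom ℚ) * symJ ℚ * (M.map (Int.castRingHom ℚ))ᵀ = (c : ℚ) • symJ ℚ := by
  rw [← symJ_map (Int.castRingHom ℚ), ← transpose_map, ← Matrix.map_mul, ← Matrix.map_mul, h]
  ext i j
  simp only [Matrix.map_apply, Matrix.smul_apply, smul_eq_mul, map_mul]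
  rfl

theorem alpha_similitude_of_unitary {Δ : ℕ} {h k : Matrix Blk Blk ℤ} {c : ℤ}
    (h1 : h * hermE ℤ * hᵀ + (Δ : ℤ) • (k * hermE ℤ * kᵀ) = c • hermE ℤ)
    (h2 : k * hermE ℤ * hᵀ = h * hermE ℤ * kᵀ) :
    alpha Δ h k * symJ ℤ * (alpha Δ h k)ᵀ = c • symJ ℤ := by
  have h1' : h * hermE ℤ * hᵀ + ((Δ : ℕ) : ℤ) • (k * hermE ℤ * kᵀ) = c • hermE ℤ := h1
  rw [alpha_similitude, h1', h2, sub_self, symJ, fromBlocks_smul]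
  simp only [Matrix.smul_mul, Matrix.mul_smul, hermE_mul_hermE, Matrix.mul_zero, Matrix.zero_mul,
    smul_zero, smul_neg]

theorem map_alpha_mul_rho (Δ : ℕ) (h k : Matrix Blk Blk ℤ) :
    (alpha Δ h k).map (Int.castRingHom ℚ) * rho Δ ℚ =
      rho Δ ℚ * (alpha Δ h k).map (Int.castRingHom ℚ) := by
  rw [← rho_map Δ (Int.castRingHom ℚ), ← Matrix.map_mul, alpha_mul_rho, Matrix.map_mul]

/-- The symplectic products of the last rows of `σ` and of `alpha Δ h k` are divisible by `N` if `k`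
is; they make up the lower left block of `σ (alpha Δ h k)⁻¹`. -/
theorem dvd_lowerRight {N p : ℕ} {Δ : ℕ} (σ : OpenRep) {h k : Matrix Blk Blk ℤ}
    (hk : ∀ i j, (N : ℤ) ∣ k i j) (i j : Blk) :
    (N : ℤ) ∣ (σ.mat p * symJ ℤ * (alpha Δ h k)ᵀ) (.inr i) (.inr j) := by
  have h1 : (σ.mat p * symJ ℤ * (alpha Δ h k)ᵀ) (.inr i) (.inr j) =
      ((Δ : ℤ) • ((σ.mat p).toBlocks₂₂ * (hermE ℤ * k)ᵀ)) i j := by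
    simp only [OpenRep.mat, symJ, alpha, fromBlocks_multiply, fromBlocks_transpose,
      fromBlocks_apply₂₂, toBlocks_fromBlocks₂₂]
    simp [-zsmul_eq_mul, -natCast_zsmul]
  rw [h1, Matrix.smul_apply, smul_eq_mul]
  refine Dvd.dvd.mul_left ?_ _
  rw [Matrix.mul_apply]
  refine Finset.dvd_sum fun l _ => Dvd.dvd.mul_left ?_ _
  rw [Matrix.transpose_apply, Matrix.mul_apply]
  exact Finset.dvd_sum fun l _ => Dvd.dvd.mul_left (hk _ _) _

/-- If the rows of `σ` are orthogonal modulo `p²` to those of an integral similitude `B` of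
multiplier `p²`, then `σ B⁻¹` is integral. -/
theorem mul_inv_mem_Gam {p N : ℕ} [hp : Fact p.Prime] (hpN : ¬ p ∣ N) {Δ : ℕ} (σ : OpenRep)
    (β : GSp ℚ) (h k : Matrix Blk Blk ℤ) (hβ : toMat β = (alpha Δ h k).map (Int.castRingHom ℚ))
    (hβ' : toMat β * symJ ℚ * (toMat β)ᵀ = (unitSq p : ℚ) • symJ ℚ)
    (hk : ∀ i j, (N : ℤ) ∣ k i j)
    (H : ∀ i j, (p : ℤ) ^ 2 ∣ (σ.mat p * symJ ℤ * (alpha Δ h k)ᵀ) i j) :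
    σ.toGSp p * β⁻¹ ∈ gamSubgroup N := by
  have hp0 : ((p : ℚ) ^ 2) ≠ 0 := pow_ne_zero 2 (Nat.cast_ne_zero.mpr hp.out.ne_zero)
  choose K hK using H
  have hG : σ.mat p * symJ ℤ * (alpha Δ h k)ᵀ = (p : ℤ) ^ 2 • Matrix.of K := by
    ext i j; simp [hK]
  have hmat : toMat (σ.toGSp p * β⁻¹) = (-(Matrix.of K * symJ ℤ)).map (Int.castRingHom ℚ) := by
    have h1 : toMat (σ.toGSp p * β⁻¹) = -((p : ℚ) ^ 2)⁻¹ •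
        (σ.mat p * symJ ℤ * (alpha Δ h k)ᵀ * symJ ℤ).map (Int.castRingHom ℚ) := by
      rw [toMat_mul, toMat_inv_eq β _ hβ', hβ, toMat_toGSp, ← symJ_map (Int.castRingHom ℚ),
        ← transpose_map, Matrix.mul_smul]
      simp only [← Matrix.map_mul, Matrix.mul_assoc]
      rfl
    rw [h1, hG, Matrix.smul_mul]
    ext i j
    simp only [Matrix.smul_apply, Matrix.map_apply, Matrix.neg_apply, smul_eq_mul, map_mul,
      map_pow, map_natCast, map_neg]
    rw [neg_mul, ← mul_assoc, inv_mul_cancel₀ hp0, one_mul]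
  have hsim : toMat (σ.toGSp p * β⁻¹) * symJ ℚ * (toMat (σ.toGSp p * β⁻¹))ᵀ = symJ ℚ := by
    refine smul_right_injective _ hp0 ?_
    have h1 : toMat (σ.toGSp p * β⁻¹) * toMat β = toMat (σ.toGSp p) := by
      rw [← toMat_mul]; simp
    have h2 : toMat (σ.toGSp p) * symJ ℚ * (toMat (σ.toGSp p))ᵀ = ((p : ℚ) ^ 2) • symJ ℚ :=
      sigmaMat_similitude p σ ℚ
    have h3 : (unitSq p : ℚ) = (p : ℚ) ^ 2 := rfl
    simp only
    rw [← h2, ← h1, transpose_mul, ← h3]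
    have h4 : ∀ X : Matrix Idx Idx ℚ, X * toMat β * symJ ℚ * ((toMat β)ᵀ * Xᵀ) =
        X * (toMat β * symJ ℚ * (toMat β)ᵀ) * Xᵀ := fun X => by
      simp only [Matrix.mul_assoc]
    rw [h4, hβ', Matrix.mul_smul, Matrix.smul_mul]
  refine mem_Gam_of_int hmat ?_ fun i j => ?_
  · rw [hmat, ← symJ_map (Int.castRingHom ℚ), ← transpose_map, ← Matrix.map_mul,
      ← Matrix.map_mul] at hsim
    exact Matrix.map_injective (RingHom.injective_int _) hsim
  · have h1 : (-(Matrix.of K * symJ ℤ)) (.inr i) (.inl j) = K (.inr i) (.inr j) := by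
      simp [symJ, Matrix.mul_apply, Fintype.sum_sum_type, Matrix.one_apply]
    rw [h1]
    have h2 := dvd_lowerRight (p := p) (Δ := Δ) σ (h := h) hk i j
    rw [hK] at h2
    have hcop : IsCoprime (N : ℤ) ((p : ℤ) ^ 2) :=
      (isCoprime_of_not_dvd (by exact_mod_cast hpN)).symm.pow_right
    exact hcop.dvd_of_dvd_mul_left h2

/-- Each stable representative lies in `Γ β (Γ ∩ G_V(ℚ))`, for one and the same `β ∈ G_V(ℚ)`. -/
theorem exists_factorization {p N Δ : ℕ} [hp : Fact p.Prime] (hp2 : p ≠ 2) (hpN : ¬ p ∣ N)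
    (hinert : legendreSym p (-(Δ : ℤ)) = -1) :
    ∃ β ∈ GV Δ ℚ, ∀ σ : OpenRep, Stable Δ p σ → ∃ γ' ∈ gamSubgroup N, ∃ γ ∈ gamSubgroup N,
      γ ∈ GV Δ ℚ ∧ σ.toGSp p = γ' * β * γ := by
  obtain ⟨e, he⟩ : ∃ e : ℤ, (p : ℤ) ^ 2 = 2 * e + 1 := by
    have h1 : Odd ((p : ℤ) ^ 2) := by
      have := (hp.out.odd_of_ne_two hp2).pow (n := 2)
      exact_mod_cast this
    exact h1
  have hcop : IsCoprime ((p : ℤ) ^ 2) (2 * N) := by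
    refine IsCoprime.pow_left (isCoprime_of_not_dvd fun h => ?_)
    rcases (Nat.prime_iff_prime_int.mp hp.out).dvd_or_dvd h with h | h
    · have : p ∣ 2 := by exact_mod_cast h
      exact hp2 ((Nat.prime_dvd_prime_iff_eq hp.out Nat.prime_two).mp this)
    · exact hpN (by exact_mod_cast h)
  have hβ := map_similitude (alpha_similitude_of_unitary (Δ := Δ) (h := heckeH p e) (k := 0)
    (c := (p : ℤ) ^ 2) (by rw [heckeH_unitary he]; simp) (by simp))
  let β : GSp ℚ := GSp.mk _ (unitSq p) (hβ.trans (by push_cast; rfl))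
  refine ⟨β, (mem_GV_iff Δ β).mpr (map_alpha_mul_rho Δ _ _), fun σ hσ => ?_⟩
  obtain ⟨n, y, d₁, d₂, hn, hy, hd, h0, h1, h2⟩ :=
    exists_unipotent_parameters hcop (herVec Δ (σ.mat p (.inl (.inr 0))))
      (hσ.dvd_herForm _ _) (hσ.isCoprime_norm hinert)
  have hγint := alpha_similitude_of_unitary (Δ := Δ) (h := unipH n d₁) (k := unipK y d₂) (c := 1)
    (by rw [unip_unitary hn, one_smul]) (unip_unitary' n y d₁ d₂)
  let γ : GSp ℚ := GSp.mk _ 1 ((map_similitude hγint).trans (by simp))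
  have hK : ∀ i j, (N : ℤ) ∣ unipK y d₂ i j := by
    rintro (i | i) (j | j) <;> fin_cases i <;> fin_cases j <;> simp [unipK, hy, hd]
  have hγ : γ ∈ gamSubgroup N := by
    refine mem_Gam_of_int (M := alpha Δ (unipH n d₁) (unipK y d₂)) rfl
      (by rw [hγint, one_smul]) fun i j => ?_
    simp only [alpha, fromBlocks_apply₂₁, Matrix.neg_apply, Matrix.smul_apply, smul_eq_mul,
      dvd_neg]
    rw [Matrix.mul_apply]
    exact Dvd.dvd.mul_left (Finset.dvd_sum fun l _ => Dvd.dvd.mul_left (hK _ _) _) _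
  refine ⟨σ.toGSp p * (β * γ)⁻¹, ?_, γ, hγ, (mem_GV_iff Δ γ).mpr (map_alpha_mul_rho Δ _ _),
    by group⟩
  have hmat : toMat (β * γ) = (alpha Δ (heckeH p e * unipH n d₁) (heckeH p e * unipK y d₂)).map
      (Int.castRingHom ℚ) := by
    rw [← alpha_zero_mul_alpha, Matrix.map_mul]; rfl
  refine mul_inv_mem_Gam hpN σ _ _ _ hmat ?_ (fun i j => ?_) fun r => ?_
  · have h4 : ∀ X Y : Matrix Idx Idx ℚ, X * Y * symJ ℚ * (X * Y)ᵀ =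
        X * (Y * symJ ℚ * Yᵀ) * Xᵀ := fun X Y => by
      simp only [Matrix.mul_assoc, transpose_mul]
    have h5 : toMat γ * symJ ℚ * (toMat γ)ᵀ = symJ ℚ :=
      (map_similitude hγint).trans (by simp)
    rw [toMat_mul, h4, h5]
    exact hβ.trans (by push_cast; rfl)
  · rw [Matrix.mul_apply]
    exact Finset.dvd_sum fun l _ => Dvd.dvd.mul_left (hK _ _) _
  · refine dvd_symplectic_of_dvd_herForm _ _ _ r ?_
    refine dvd_herForm_hecke_unip he _ _ (hσ.isCoprime_norm hinert) h0 h1 h2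
      (hσ.dvd_herForm _ _) ?_
    -- modulo `p` only the second block row survives, and it spans a line
    intro i j
    have hzero : (∀ i, ((p : ℤ) : ℤ√(-(Δ : ℤ))) ∣ herVec Δ (σ.mat p r) i) →
        ((p : ℤ) : ℤ√(-(Δ : ℤ))) ∣
          herVec Δ (σ.mat p r) i * herVec Δ (σ.mat p (.inl (.inr 0))) j -
            herVec Δ (σ.mat p r) j * herVec Δ (σ.mat p (.inl (.inr 0))) i :=
      fun h => dvd_sub (Dvd.dvd.mul_right (h i) _) (Dvd.dvd.mul_right (h j) _)
    rcases r with (r | r) | (r | r) <;> fin_cases r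
    · refine hzero fun i => ?_
      rw [Zsqrtd.intCast_dvd]
      rcases i with i | i <;> fin_cases i <;> 
        simp [herVec, OpenRep.mat, Matrix.one_apply, -zsmul_eq_mul, -natCast_zsmul, -zsmul_one]
    · refine (dvd_zero _).trans (dvd_of_eq ?_)
      exact (sub_eq_zero.mpr (mul_comm _ _)).symm
    · have := hσ.dvd_minor hinert j i
      simp only [Fin.mk_one]
      convert this using 1
      ring
    all_goals
      refine hzero fun i => ?_
      rw [Zsqrtd.intCast_dvd]
      rcases i with i | i <;> fin_cases i <;> 
        simp [herVec, OpenRep.mat, Matrix.one_apply, -zsmul_eq_mul, -natCast_zsmul, -zsmul_one]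

end Factorization

/-! ### Existence of stable representatives -/

section Existence

theorem gram_transpose (Δ p : ℕ) (σ : OpenRep) : (gram Δ p σ)ᵀ = gram Δ p σ := by
  have h : (fromBlocks (hermE ℤ) 0 0 ((Δ : ℤ) • hermE ℤ))ᵀ =
      fromBlocks (hermE ℤ) 0 0 ((Δ : ℤ) • hermE ℤ) := by
    rw [fromBlocks_transpose, transpose_smul, hermE_transpose, transpose_zero]
  rw [gram, transpose_mul, transpose_mul, transpose_transpose, h, Matrix.mul_assoc]

theorem mul_dvd_gram {Δ p : ℕ} {σ : OpenRep} {n m : ℤ} {i j : Idx} (hi : ∀ l, n ∣ σ.mat p i l)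
    (hj : ∀ l, m ∣ σ.mat p j l) : n * m ∣ gram Δ p σ i j := by
  rw [gram, Matrix.mul_apply]
  refine Finset.dvd_sum fun l _ => mul_dvd_mul ?_ (hj l)
  rw [Matrix.mul_apply]
  exact Finset.dvd_sum fun k _ => Dvd.dvd.mul_right (hi k) _

/-- Stability when `A` and `C` vanish modulo `p`: only the products of the second block row with
itself need to be looked at. -/
theorem stable_of_dvd {Δ p : ℕ} {σ : OpenRep} (hA : ∀ i, (p : ℤ) ∣ σ.A i 0)
    (hC : ∀ i, (p : ℤ) ∣ σ.C i 0)
    (hU : ∀ i j, (p : ℤ) ^ 2 ∣ gram Δ p σ (.inl (.inr i)) (.inl (.inr j))) : Stable Δ p σ := by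
  have hsymm : ∀ i j, gram Δ p σ i j = gram Δ p σ j i := fun i j =>
    congrFun (congrFun (gram_transpose Δ p σ).symm i) j
  have hrow : ∀ i, (∀ a, i ≠ .inl (.inr a)) → ∀ l, (p : ℤ) ∣ σ.mat p i l := by
    rintro ((i | i) | (i | i)) hi
    case inl.inr => exact absurd rfl (hi i)
    all_goals
      rintro ((l | l) | (l | l)) <;> fin_cases i <;> fin_cases l <;>
        simp [OpenRep.mat, -zsmul_eq_mul, -natCast_zsmul, -zsmul_one]
  have hlast : ∀ i j, (p : ℤ) ^ 2 ∣ gram Δ p σ (.inl (.inr i)) (.inr (.inr j)) := fun i j => by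
    have h : ∀ l, (p : ℤ) ^ 2 ∣ σ.mat p (.inr (.inr j)) l := by
      rintro ((l | l) | (l | l)) <;> fin_cases j <;> fin_cases l <;>
        simp [OpenRep.mat, -zsmul_eq_mul, -natCast_zsmul, -zsmul_one]
    simpa using mul_dvd_gram (Δ := Δ) (i := .inl (.inr i)) (n := 1) (fun _ => one_dvd _) h
  have hmid : ∀ i j, (∀ a, j ≠ .inl (.inr a)) →
      (p : ℤ) ^ 2 ∣ gram Δ p σ (.inl (.inr i)) j := by
    rintro i ((j | j) | (j | j)) hj
    · fin_cases j
      simp only [Fin.zero_eta, gram_inl_inr, dvd_neg, pow_two]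
      exact mul_dvd_mul_left _ (dvd_add (hA _) (Dvd.dvd.mul_left
        (dvd_add (Dvd.dvd.mul_left (hC _) _) (Dvd.dvd.mul_left (hC _) _)) _))
    · exact absurd rfl (hj j)
    · fin_cases j
      simp only [Fin.zero_eta, gram_inr_inl, pow_two]
      exact mul_dvd_mul_left _ (Dvd.dvd.mul_left (dvd_sub (hC _)
        (dvd_add (Dvd.dvd.mul_left (hA _) _) (Dvd.dvd.mul_left (hA _) _))) _)
    · exact hlast i j
  intro i j
  by_cases hi : ∃ a, i = .inl (.inr a)
  · obtain ⟨a, rfl⟩ := hi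
    by_cases hj : ∃ b, j = .inl (.inr b)
    · obtain ⟨b, rfl⟩ := hj
      exact hU a b
    · exact hmid a j (not_exists.mp hj)
  · by_cases hj : ∃ b, j = .inl (.inr b)
    · obtain ⟨b, rfl⟩ := hj
      rw [hsymm]
      exact hmid b i (not_exists.mp hi)
    · rw [pow_two]
      exact mul_dvd_gram (hrow i (not_exists.mp hi)) (hrow j (not_exists.mp hj))

variable {p Δ : ℕ} [hp : Fact p.Prime]

/-- Hensel's lemma for the equation `Δ (a² + b²) = -1`. -/
theorem exists_lift_sum_sq (hp2 : p ≠ 2) (hΔ : ¬ (p : ℤ) ∣ Δ) {a b : ℤ} (ha : ¬ (p : ℤ) ∣ a)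
    (h : (p : ℤ) ∣ Δ * (a ^ 2 + b ^ 2) + 1) :
    ∃ a' : ℤ, (p : ℤ) ^ 2 ∣ Δ * (a' ^ 2 + b ^ 2) + 1 := by
  have hp' := Nat.prime_iff_prime_int.mp hp.out
  obtain ⟨t, ht⟩ := h
  have hcop : IsCoprime (p : ℤ) (2 * Δ * a) := by
    refine isCoprime_of_not_dvd fun h => ?_
    rcases hp'.dvd_or_dvd h with h | h
    · rcases hp'.dvd_or_dvd h with h | h
      · have : p ∣ 2 := by exact_mod_cast h
        exact hp2 ((Nat.prime_dvd_prime_iff_eq hp.out Nat.prime_two).mp this)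
      · exact hΔ h
    · exact ha h
  obtain ⟨u, v, huv⟩ := hcop
  exact ⟨a + p * (-t * v), t * u + Δ * t ^ 2 * v ^ 2, by
    linear_combination ht - p * t * huv⟩

theorem exists_sum_sq (hp2 : p ≠ 2) (hΔ : ¬ (p : ℤ) ∣ Δ) :
    ∃ a b : ℤ, (p : ℤ) ^ 2 ∣ Δ * (a ^ 2 + b ^ 2) + 1 := by
  have hΔ' : (Δ : ZMod p) ≠ 0 := by
    intro h
    exact hΔ (by exact_mod_cast (ZMod.natCast_eq_zero_iff _ _).mp h)
  obtain ⟨a, b, hab⟩ := ZMod.sq_add_sq p (-(Δ : ZMod p)⁻¹)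
  obtain ⟨a, rfl⟩ := ZMod.intCast_surjective a
  obtain ⟨b, rfl⟩ := ZMod.intCast_surjective b
  have h : (p : ℤ) ∣ Δ * (a ^ 2 + b ^ 2) + 1 := by
    rw [← ZMod.intCast_zmod_eq_zero_iff_dvd]
    push_cast
    rw [hab]
    field_simp
    ring
  by_cases ha : (p : ℤ) ∣ a
  · by_cases hb : (p : ℤ) ∣ b
    · exfalso
      have h1 : (p : ℤ) ∣ Δ * (a ^ 2 + b ^ 2) :=
        Dvd.dvd.mul_left (dvd_add (dvd_pow ha two_ne_zero) (dvd_pow hb two_ne_zero)) _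
      exact (Nat.prime_iff_prime_int.mp hp.out).not_dvd_one ((dvd_add_right h1).mp h)
    · rw [add_comm (a ^ 2)] at h
      obtain ⟨b', hb'⟩ := exists_lift_sum_sq hp2 hΔ hb h
      exact ⟨b', a, hb'⟩
  · obtain ⟨a', ha'⟩ := exists_lift_sum_sq hp2 hΔ ha h
    exact ⟨a', b, ha'⟩

theorem exists_stable (hp2 : p ≠ 2) (hinert : legendreSym p (-(Δ : ℤ)) = -1) {R₁ R₂ : Set ℤ}
    (hR₁ : IsResidueSystem p R₁) (hR₂ : IsResidueSystem (p ^ 2) R₂) :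
    ∃ σ ∈ SOpen R₁ R₂, Stable Δ p σ := by
  obtain ⟨a, b, hab⟩ := exists_sum_sq (p := p) hp2 (not_dvd_of_legendreSym hinert)
  obtain ⟨r, ⟨hr, hr0⟩, -⟩ := hR₁ 0
  obtain ⟨u, ⟨hu, hu0⟩, -⟩ := hR₂ a
  obtain ⟨v, ⟨hv, hv0⟩, -⟩ := hR₂ b
  obtain ⟨w, ⟨hw, hw0⟩, -⟩ := hR₂ (-a)
  obtain ⟨c, rfl⟩ : (p : ℤ) ∣ r := by simpa using hr0
  -- `A = C`, both divisible by `p`, so that `U` may be symmetric, with `Δ U² = -1`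
  let σ : OpenRep :=
    { A := fun _ _ => p * c
      C := fun _ _ => p * c
      U := !![u, v; v, w]
      rel := by
        ext i j; fin_cases i <;> fin_cases j <;> simp }
  refine ⟨σ, ⟨fun _ _ => hr, fun _ _ => hr, fun i j hij => ?_⟩,
    stable_of_dvd (fun _ => ⟨c, rfl⟩) (fun _ => ⟨c, rfl⟩) fun i j => ?_⟩
  · fin_cases i <;> fin_cases j <;> simp [σ, hu, hv, hw] at hij ⊢
  · have hpp : (p : ZMod (p ^ 2)) ^ 2 = 0 := natCast_sq_eq_zero p
    have hcast : ∀ x : ℤ, ((p ^ 2 : ℕ) : ℤ) ∣ x → (x : ZMod (p ^ 2)) = 0 := fun x hx =>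
      (ZMod.intCast_zmod_eq_zero_iff_dvd x (p ^ 2)).mpr hx
    have e1 := hcast _ hu0
    have e2 := hcast _ hv0
    have e3 := hcast _ hw0
    have e4 := hcast _ (by exact_mod_cast hab)
    push_cast at e1 e2 e3 e4
    have f1 : (w : ZMod (p ^ 2)) = -u := by linear_combination -e1 - e3
    have f2 : (Δ : ZMod (p ^ 2)) * (u ^ 2 + v ^ 2) + 1 = 0 := by
      rw [← e4, sub_eq_zero.mp e1, sub_eq_zero.mp e2]
    have h0 : ((gram Δ p σ (.inl (.inr i)) (.inl (.inr j)) : ℤ) : ZMod (p ^ 2)) = 0 := by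
      rw [gram_inr_inr]
      fin_cases i <;> fin_cases j <;> simp [σ, f1]
      · linear_combination (1 + (Δ : ZMod (p ^ 2))) * (c : ZMod (p ^ 2)) ^ 2 * hpp - f2
      · linear_combination (1 + (Δ : ZMod (p ^ 2))) * (c : ZMod (p ^ 2)) ^ 2 * hpp
      · linear_combination (1 + (Δ : ZMod (p ^ 2))) * (c : ZMod (p ^ 2)) ^ 2 * hpp
      · linear_combination (1 + (Δ : ZMod (p ^ 2))) * (c : ZMod (p ^ 2)) ^ 2 * hpp - f2
    have h := (ZMod.intCast_zmod_eq_zero_iff_dvd _ (p ^ 2)).mp h0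
    exact_mod_cast h

end Existence

/-! ### Components of the Hecke transform -/

section Components

variable {N p Δ : ℕ} [hp : Fact p.Prime]

theorem isIntegralMat_of_mem_level {k : GSp Af} (hk : k ∈ levelSubgroup N) :
    IsIntegralMat (toMat k) := fun i j => hk.1 i j

theorem toGam_mem (σ : OpenRep) : σ.toGam p ∈ gamSubgroup N := by
  have hτ : toMat (tau p) = tauMat p ℚ := rfl
  have hmat : toMat (σ.toGam p) = σ.unip.map (Int.castRingHom ℚ) := by
    rw [OpenRep.toGam, toMat_mul]
    change toMat (tau p)⁻¹ * sigmaMat p σ ℚ = _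
    rw [sigmaMat_eq, ← Matrix.mul_assoc, ← hτ, toMat_inv_mul, Matrix.one_mul]
  refine mem_Gam_of_int hmat σ.unip_similitude fun i j => ?_
  simp [OpenRep.unip]

theorem tau_mul_toGam (σ : OpenRep) : tau p * σ.toGam p = σ.toGSp p := by
  simp [OpenRep.toGam]

/-- The lattice `Ẑ⁶ x` is stable under `√-Δ`. -/
def IsStableAt (Δ : ℕ) (x : GSp Af) : Prop :=
  IsIntegralMat (toMat x * rho Δ Af * toMat x⁻¹)

theorem isStableAt_one (Δ : ℕ) : IsStableAt Δ 1 := by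
  have h := isIntegralMat_map_intCast (rho Δ ℤ)
  rw [rho_map] at h
  simpa [IsStableAt] using h

theorem IsStableAt.mul_left {k x : GSp Af} (h : IsStableAt Δ x) (hk : k ∈ levelSubgroup N) :
    IsStableAt Δ (k * x) := by
  have h1 := ((isIntegralMat_of_mem_level hk).mul h).mul
    (isIntegralMat_of_mem_level ((levelSubgroup N).inv_mem hk))
  simpa only [IsStableAt, toMat_mul, _root_.mul_inv_rev, Matrix.mul_assoc] using h1

theorem isStableAt_mul_left {k x : GSp Af} (hk : k ∈ levelSubgroup N) :
    IsStableAt Δ (k * x) ↔ IsStableAt Δ x := by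
  refine ⟨fun h => ?_, fun h => h.mul_left hk⟩
  simpa using h.mul_left ((levelSubgroup N).inv_mem hk)

theorem isStableAt_mul_right {x g : GSp Af} (hg : g ∈ GV Δ Af) :
    IsStableAt Δ (x * g) ↔ IsStableAt Δ x := by
  have h1 : toMat (x * g) * rho Δ Af * toMat (x * g)⁻¹ = toMat x * rho Δ Af * toMat x⁻¹ := by
    have h2 : toMat g * rho Δ Af * toMat g⁻¹ = rho Δ Af := by
      rw [(mem_GV_iff Δ g).mp hg, Matrix.mul_assoc, toMat_mul_inv, Matrix.mul_one]
    rw [_root_.mul_inv_rev, toMat_mul, toMat_mul]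
    calc _ = toMat x * (toMat g * rho Δ Af * toMat g⁻¹) * toMat x⁻¹ := by
          simp only [Matrix.mul_assoc]
      _ = _ := by rw [h2]
  rw [IsStableAt, h1, IsStableAt]

theorem stable_iff_isStableAt (σ : OpenRep) :
    Stable Δ p σ ↔ IsStableAt Δ (diagA (σ.toGSp p)) :=
  (isIntegralMat_conj_iff p Δ σ).symm

theorem diagA_mem_GV {q : GSp ℚ} (hq : q ∈ GV Δ ℚ) : diagA q ∈ GV Δ Af :=
  map_mem_GV (algebraMap ℚ Af) hq

theorem compI_eq (N Δ : ℕ) (σ : OpenRep) :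
    compI N p Δ σ = {x | ∃ z ∈ DomV Δ, x = pt (level N) (act (σ.toGSp p) z) 1} := by
  have key : ∀ z, proj2 N p (pt (levelP N p) (act (σ.toGam p) z) 1) =
      pt (level N) (act (σ.toGSp p) z) 1 := fun z => by
    change pt (level N) (act (tau p) (act (σ.toGam p) z))
      (diagA (tau p) * 1 * (diagA (tau p))⁻¹) = _
    rw [← act_mul, tau_mul_toGam, mul_one, mul_inv_cancel]
  ext x
  constructor
  · rintro ⟨_, ⟨z, hz, rfl⟩, rfl⟩
    exact ⟨z, hz, key z⟩
  · rintro ⟨z, hz, rfl⟩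
    exact ⟨_, ⟨z, hz, rfl⟩, key z⟩

theorem compD_eq (N Δ : ℕ) (σ : OpenRep) :
    compD N p Δ σ = {x | ∃ z ∈ DomV Δ, ∃ g ∈ GV Δ Af, x = pt (level N) (act (σ.toGSp p) z)
      (diagA (σ.toGSp p) * g * (diagA (σ.toGSp p))⁻¹)} := by
  have key : ∀ z g, proj2 N p (pt (levelP N p) (act (σ.toGam p) z)
      (diagA (σ.toGam p) * g * (diagA (σ.toGam p))⁻¹)) = pt (level N) (act (σ.toGSp p) z)
      (diagA (σ.toGSp p) * g * (diagA (σ.toGSp p))⁻¹) := fun z g => by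
    change pt (level N) (act (tau p) (act (σ.toGam p) z)) (diagA (tau p) *
      (diagA (σ.toGam p) * g * (diagA (σ.toGam p))⁻¹) * (diagA (tau p))⁻¹) = _
    rw [← act_mul, ← tau_mul_toGam, map_mul]
    group
  ext x
  constructor
  · rintro ⟨_, ⟨z, hz, g, hg, rfl⟩, rfl⟩
    exact ⟨z, hz, g, hg, key z g⟩
  · rintro ⟨z, hz, g, hg, rfl⟩
    exact ⟨_, ⟨z, hz, g, hg, rfl⟩, key z g⟩

theorem subVc_subset_subV (N Δ : ℕ) : subVc N Δ ⊆ subV N Δ := by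
  rintro _ ⟨z, hz, rfl⟩
  exact ⟨z, hz, 1, one_mem_GV Δ, rfl⟩

/-- If the image of the generic point lies in `V`, then the lattice of `σ` is stable. -/
theorem stable_of_forall_mem_subV (hΔ : 0 < Δ) (σ : OpenRep)
    (h : ∀ z ∈ DomV Δ, pt (level N) (act (σ.toGSp p) z) 1 ∈ subV N Δ) : Stable Δ p σ := by
  obtain ⟨z, hz, hgen⟩ := exists_generic_point hΔ
  obtain ⟨z', hz', g, hg, heq⟩ := h z hz
  obtain ⟨q, k, hk, h1, h2⟩ := (pt_eq_pt_iff (levelSubgroup N) _ _ _ _).mp heq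
  rw [← act_mul] at h1
  have hq : q * σ.toGSp p ∈ GV Δ ℚ := (mem_GV_iff Δ _).mpr (hgen _ (h1 ▸ hz'))
  have h3 : diagA (σ.toGSp p) = k⁻¹ * (1 * (g * diagA (q * σ.toGSp p))) := by
    rw [h2, map_mul]; group
  rw [stable_iff_isStableAt, h3, isStableAt_mul_left ((levelSubgroup N).inv_mem hk),
    isStableAt_mul_right (mul_mem_GV hg (diagA_mem_GV hq))]
  exact isStableAt_one Δ

theorem stable_of_compI_eq (hΔ : 0 < Δ) (σ : OpenRep) (h : compI N p Δ σ = subVc N Δ) :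
    Stable Δ p σ := by
  refine stable_of_forall_mem_subV (N := N) hΔ σ fun z hz => subVc_subset_subV N Δ ?_
  rw [← h, compI_eq]
  exact ⟨z, hz, rfl⟩

theorem stable_of_compD_eq (hΔ : 0 < Δ) (σ : OpenRep) (h : compD N p Δ σ = subV N Δ) :
    Stable Δ p σ := by
  refine stable_of_forall_mem_subV (N := N) hΔ σ fun z hz => ?_
  rw [← h, compD_eq]
  exact ⟨z, hz, 1, one_mem_GV Δ, by simp⟩

/-- Whether the lattice of `σ` is stable depends only on the subvariety of `X_p` that contains the
component of `σ`. -/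
theorem stable_iff_of_compP_subset (hΔ : 0 < Δ) {σ : OpenRep} {s : GSp ℚ}
    (h : compP N p Δ (σ.toGam p) ⊆ conjV N p Δ s) :
    Stable Δ p σ ↔ IsStableAt Δ (diagA (tau p * s)) := by
  obtain ⟨z, hz, hgen⟩ := exists_generic_point hΔ
  obtain ⟨z', hz', g, hg, heq⟩ := h ⟨z, hz, rfl⟩
  obtain ⟨q, k, hk, h1, h2⟩ := (pt_eq_pt_iff (levelPSubgroup N p) _ _ _ _).mp heq
  have h1' : z' = act (s⁻¹ * q * σ.toGam p) z := by
    rw [act_mul, act_mul, ← h1, ← act_mul, inv_mul_cancel, act_one]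
  have hη : s⁻¹ * q * σ.toGam p ∈ GV Δ ℚ := (mem_GV_iff Δ _).mpr (hgen _ (h1' ▸ hz'))
  have hk' : diagA (tau p) * k * (diagA (tau p))⁻¹ ∈ levelSubgroup N := hk.2
  have h3 : diagA (σ.toGSp p) = (diagA (tau p) * k * (diagA (tau p))⁻¹)⁻¹ *
      (diagA (tau p * s) * (g * diagA (s⁻¹ * q * σ.toGam p))) := by
    have h4 : k * (diagA q)⁻¹ = diagA s * g * (diagA s)⁻¹ := by rw [h2, mul_one]
    have h5 : diagA s * g = k * (diagA q)⁻¹ * diagA s := by rw [h4]; group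
    rw [← tau_mul_toGam]
    simp only [map_mul, map_inv]
    calc _ = (diagA (tau p) * k * (diagA (tau p))⁻¹)⁻¹ * (diagA (tau p) *
          (k * (diagA q)⁻¹ * diagA s) * ((diagA s)⁻¹ * diagA q * diagA (σ.toGam p))) := by group
      _ = _ := by rw [← h5]; group
  rw [stable_iff_isStableAt, h3, isStableAt_mul_left ((levelSubgroup N).inv_mem hk'),
    isStableAt_mul_right (mul_mem_GV hg (diagA_mem_GV hη))]

theorem DEquiv.stable_iff (hΔ : 0 < Δ) {σ₁ σ₂ : OpenRep} (h : DEquiv N p Δ σ₁ σ₂) :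
    Stable Δ p σ₁ ↔ Stable Δ p σ₂ := by
  obtain ⟨s, -, h1, h2⟩ := h
  rw [stable_iff_of_compP_subset hΔ h1, stable_iff_of_compP_subset hΔ h2]

theorem compP_subset_conjV (N Δ : ℕ) (s : GSp ℚ) : compP N p Δ s ⊆ conjV N p Δ s := by
  rintro _ ⟨z, hz, rfl⟩
  exact ⟨z, hz, 1, one_mem_GV Δ, by simp⟩

/-- If `σᵢ = γᵢ' β γᵢ`, then `τ⁻¹ γ₂' γ₁'⁻¹ τ` lies in `𝒦_p` and carries the component of `σ₁`,
moved by `γ₁⁻¹ γ₂ ∈ G_V(ℚ)`, to that of `σ₂`. -/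
theorem dEquiv_of_stable (hp2 : p ≠ 2) (hpN : ¬ p ∣ N)
    (hinert : legendreSym p (-(Δ : ℤ)) = -1) {σ₁ σ₂ : OpenRep} (h1 : Stable Δ p σ₁)
    (h2 : Stable Δ p σ₂) : DEquiv N p Δ σ₁ σ₂ := by
  obtain ⟨β, hβ, H⟩ := exists_factorization (N := N) hp2 hpN hinert
  obtain ⟨γ₁', hγ₁', γ₁, hγ₁, hV₁, e1⟩ := H σ₁ h1
  obtain ⟨γ₂', hγ₂', γ₂, hγ₂, hV₂, e2⟩ := H σ₂ h2
  refine ⟨σ₁.toGam p, toGam_mem σ₁, compP_subset_conjV N Δ _, ?_⟩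
  -- `τ k τ⁻¹` lies in `Γ` by the definition of `k`, and `k` does by the expression in `hk`
  let k : GSp ℚ := (tau p)⁻¹ * (γ₂' * γ₁'⁻¹) * tau p
  have hk : k = σ₂.toGam p * (γ₂⁻¹ * γ₁) * (σ₁.toGam p)⁻¹ := by
    simp only [k, OpenRep.toGam, e1, e2]
    group
  have hkP : diagA k ∈ levelPSubgroup N p := by
    constructor
    · change k ∈ gamSubgroup N
      rw [hk]
      exact mul_mem (mul_mem (toGam_mem σ₂) (mul_mem (inv_mem hγ₂) hγ₁))
        (inv_mem (toGam_mem σ₁))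
    · change diagA (tau p) * diagA k * (diagA (tau p))⁻¹ ∈ levelSubgroup N
      have h3 : diagA (tau p) * diagA k * (diagA (tau p))⁻¹ = diagA (γ₂' * γ₁'⁻¹) := by
        rw [← map_mul, ← map_inv, ← map_mul]
        congr 1
        simp only [k]
        group
      rw [h3]
      change γ₂' * γ₁'⁻¹ ∈ gamSubgroup N
      exact mul_mem hγ₂' (inv_mem hγ₁')
  rintro _ ⟨z, hz, rfl⟩
  refine ⟨act (γ₁⁻¹ * γ₂) z, DomV_act (mul_mem_GV (inv_mem_GV hV₁) hV₂) hz, 1, one_mem_GV Δ, ?_⟩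
  rw [← act_mul]
  refine (pt_eq_pt_iff (levelPSubgroup N p) _ _ _ _).mpr
    ⟨k⁻¹, (diagA k)⁻¹, inv_mem hkP, ?_, by simp⟩
  rw [← act_mul, hk]
  congr 1
  group

/-- Multiplying `σ = γ η` by `γ⁻¹ ∈ Γ` on the left carries the component of `σ` to that of
`η ∈ G_V(ℚ)`. -/
theorem compI_eq_subVc {σ : OpenRep} {γ η : GSp ℚ} (hγ : γ ∈ gamSubgroup N) (hη : η ∈ GV Δ ℚ)
    (h : σ.toGSp p = γ * η) : compI N p Δ σ = subVc N Δ := by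
  have key : ∀ z, pt (level N) (act (σ.toGSp p) z) 1 = pt (level N) (act η z) 1 := fun z =>
    (pt_eq_pt_iff (levelSubgroup N) _ _ _ _).mpr ⟨γ⁻¹, diagA γ⁻¹,
      (gamSubgroup N).inv_mem hγ, by rw [← act_mul, h]; congr 1; group, by simp⟩
  rw [compI_eq]
  ext x
  constructor
  · rintro ⟨z, hz, rfl⟩
    exact ⟨_, DomV_act hη hz, key z⟩
  · rintro ⟨z, hz, rfl⟩
    refine ⟨act η⁻¹ z, DomV_act (inv_mem_GV hη) hz, ?_⟩
    rw [key, ← act_mul, mul_inv_cancel, act_one]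

theorem compD_eq_subV {σ : OpenRep} {γ η : GSp ℚ} (hγ : γ ∈ gamSubgroup N) (hη : η ∈ GV Δ ℚ)
    (h : σ.toGSp p = γ * η) : compD N p Δ σ = subV N Δ := by
  have key : ∀ z g, pt (level N) (act (σ.toGSp p) z)
      (diagA (σ.toGSp p) * g * (diagA (σ.toGSp p))⁻¹) =
      pt (level N) (act η z) (diagA η * g * (diagA η)⁻¹) := fun z g =>
    (pt_eq_pt_iff (levelSubgroup N) _ _ _ _).mpr ⟨γ⁻¹, diagA γ⁻¹,
      (gamSubgroup N).inv_mem hγ, by rw [← act_mul, h]; congr 1; group,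
      by rw [h, map_mul, map_inv]; group⟩
  have hη' := diagA_mem_GV hη
  rw [compD_eq]
  ext x
  constructor
  · rintro ⟨z, hz, g, hg, rfl⟩
    exact ⟨_, DomV_act hη hz, _, mul_mem_GV (mul_mem_GV hη' hg) (inv_mem_GV hη'), key z g⟩
  · rintro ⟨z, hz, g, hg, rfl⟩
    refine ⟨act η⁻¹ z, DomV_act (inv_mem_GV hη) hz, (diagA η)⁻¹ * g * diagA η,
      mul_mem_GV (mul_mem_GV (inv_mem_GV hη') hg) hη', ?_⟩
    rw [key, ← act_mul, mul_inv_cancel, act_one]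
    congr 1
    group

theorem components_of_stable (hp2 : p ≠ 2) (hpN : ¬ p ∣ N)
    (hinert : legendreSym p (-(Δ : ℤ)) = -1) {σ : OpenRep} (hσ : Stable Δ p σ) :
    compI N p Δ σ = subVc N Δ ∧ compD N p Δ σ = subV N Δ := by
  obtain ⟨β, hβ, H⟩ := exists_factorization (N := N) hp2 hpN hinert
  obtain ⟨γ', hγ', γ, -, hV, e⟩ := H σ hσ
  rw [mul_assoc] at e
  exact ⟨compI_eq_subVc hγ' (mul_mem_GV hβ hV) e, compD_eq_subV hγ' (mul_mem_GV hβ hV) e⟩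

end Components

end Picard

theorem proposition4p2p18 (p : ℕ) [Fact p.Prime] (hp2 : p ≠ 2)
    (Δ : ℕ) (hΔ : 0 < Δ) (hinert : legendreSym p (-(Δ : ℤ)) = -1)
    (N : ℕ) (hN : 0 < N) (hpN : ¬ p ∣ N)
    (R₁ R₂ : Set ℤ) (hR₁ : Picard.IsResidueSystem p R₁)
    (hR₂ : Picard.IsResidueSystem (p ^ 2) R₂) :
    (∀ σ ∈ Picard.DStar p Δ R₁ R₂,
      (Picard.compI N p Δ σ = Picard.subVc N Δ ↔ σ ∈ Picard.DZeroStar p Δ R₁ R₂)) ∧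
    Picard.IsDPart N p Δ R₁ R₂ (Picard.DZeroStar p Δ R₁ R₂) ∧
    (∀ k : Set Picard.OpenRep, Picard.IsDPart N p Δ R₁ R₂ k → ∀ σ ∈ k,
      (Picard.compI N p Δ σ = Picard.subVc N Δ ↔ k = Picard.DZeroStar p Δ R₁ R₂) ∧
      (Picard.compD N p Δ σ = Picard.subV N Δ ↔ k = Picard.DZeroStar p Δ R₁ R₂)) := by
  open Picard in
  have hmem : ∀ {σ}, σ ∈ SOpen R₁ R₂ → (σ ∈ DZeroStar p Δ R₁ R₂ ↔ Stable Δ p σ) :=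
    fun hσ => mem_DZeroStar_iff hinert hσ
  have hI : ∀ σ, compI N p Δ σ = subVc N Δ ↔ Stable Δ p σ := fun σ =>
    ⟨stable_of_compI_eq hΔ σ, fun h => (components_of_stable hp2 hpN hinert h).1⟩
  have hD : ∀ σ, compD N p Δ σ = subV N Δ ↔ Stable Δ p σ := fun σ =>
    ⟨stable_of_compD_eq hΔ σ, fun h => (components_of_stable hp2 hpN hinert h).2⟩
  -- the part of a stable representative is `𝔇_{0,*}`
  have hpart : ∀ σ, Stable Δ p σ →
      DZeroStar p Δ R₁ R₂ = {σ' | σ' ∈ SOpen R₁ R₂ ∧ DEquiv N p Δ σ σ'} := by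
    intro σ hσ
    ext σ'
    constructor
    · intro h
      exact ⟨h.1.1, dEquiv_of_stable hp2 hpN hinert hσ ((hmem h.1.1).mp h)⟩
    · rintro ⟨hσ', h⟩
      exact (hmem hσ').mpr ((h.stable_iff hΔ).mp hσ)
  refine ⟨fun σ hσ => (hI σ).trans (hmem hσ.1).symm, ?_, ?_⟩
  · obtain ⟨σ, hσ, hs⟩ := exists_stable hp2 hinert hR₁ hR₂
    exact ⟨σ, hσ, hpart σ hs⟩
  · rintro k ⟨σ₀, hσ₀, rfl⟩ σ ⟨hσ, hequiv⟩
    have hk : {σ' | σ' ∈ SOpen R₁ R₂ ∧ DEquiv N p Δ σ₀ σ'} = DZeroStar p Δ R₁ R₂ ↔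
        Stable Δ p σ := by
      refine ⟨fun h => (hmem hσ).mp ?_, fun h => ?_⟩
      · rw [← h]
        exact ⟨hσ, hequiv⟩
      · exact (hpart σ₀ ((hequiv.stable_iff hΔ).mpr h)).symm
    exact ⟨(hI σ).trans hk.symm, (hD σ).trans hk.symm⟩
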